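/- Throughout, $\log=\log_2$. For $x\in\mathbb Z^n$ let $a_1,\dots,a_n$ be the entries of $x$ rearranged so that $|a_1|\ge|a_2|\ge\dots\ge|a_n|$, and for $1\le k\le n$ let $\|x_{-k}\|_2^2=\sum_{i=k+1}^n a_i^2$. Put $|x_i|^p=0$ if $x_i=0$ (also for $p=0$). A linear sketch consists of a uniformly random bit string drawn independently of $x$, an integer matrix $\mathbf S$ with $n$ columns determined by this string, and a post-processing function which computes an estimate $Z$ from the string and $\mathbf S x$. It uses $b$ bits of space on vectors with entries bounded by $m$ if the random string together with the vector $\mathbf Sx$ (each entry written as a signed integer of fixed length) takes at most $b$ bits, for every $x\in\mathbb Z^n$ with $\max_i|x_i|\le m$ and every value of the random string. **Corollary 7.** For every constant $c\in\mathbb R$ there is an exponent $C$ such that for all constants $d\in\mathbb N$ and $\delta>0$ there is a constant $K$ with the following property. Let $n\ge 2$, $\varepsilon\in(0,1)$, $0\le p\le 2$ and $\mathcal T\ge 0$. Then there is a linear sketch that uses at most $K(\log n/\varepsilon)^{C}$ bits of space on vectors with entries bounded by $n^d$, such that the following holds for every $x\in\mathbb Z^n$ with $\max_i|x_i|\le n^d$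 and $|a_1|\ge\mathcal T$. Let $k\in\{1,\dots,n\}$ be the largest index with $|a_k|\ge \mathcal T$. If $$a_k^2\ \ge\ \Big(\frac{\varepsilon}{\log n}\Big)^{c}\cdot\frac{\|x_{-k}\|_2^2}{k},$$ then, with probability at least $1-\delta$, the estimate $Z$ satisfies $$\Big|Z-\sum_{i:\,|x_i|\ge \mathcal T}|x_i|^p\Big|\ \le\ \varepsilon\sum_{i:\,|x_i|\ge \mathcal T}|x_i|^p\;+\;(1+\varepsilon)\,\mathcal T^p\cdot\#\{i:\ |x_i|\in[(1-\varepsilon)\mathcal T,\mathcal T)\}.$$ -/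

import Mathlib

/-- A randomized linear sketch for integer vectors of dimension `n`.  A uniformly random string of
`seedLength` bits, drawn independently of the input, determines an integer matrix; the sketch of
`x` is the product of this matrix with `x`.  After the stream, an estimate is computed from the
seed and the sketch. -/
structure LinearSketch (n : ℕ) where
  /-- number of random bits -/
  seedLength : ℕ
  /-- sketching dimension -/
  rows : ℕ
  /-- the random sketching matrix -/
  matrix : (Fin seedLength → Bool) → Matrix (Fin rows) (Fin n) ℤ
  /-- the post-processing -/
  decode : (Fin seedLength → Bool) → (Fin rows → ℤ) → ℝ

namespace LinearSketch

/-- The estimate produced on input `x` with random string `s`. -/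
def output {n : ℕ} (S : LinearSketch n) (s : Fin S.seedLength → Bool) (x : Fin n → ℤ) : ℝ :=
  S.decode s ((S.matrix s).mulVec x)

/-- On integer vectors with entries bounded by `m` in absolute value, the sketch uses at most `b`
bits of space: the random string is stored, and each of the `rows` entries of the sketch fits,
whatever the random string, into a word of one sign bit and `w` further bits.  Since the bound
holds for every such vector, it holds at each moment of a turnstile stream during which all
frequencies remain bounded by `m`. -/
def UsesBits {n : ℕ} (S : LinearSketch n) (m : ℕ) (b : ℝ) : Prop :=
  ∃ w : ℕ,
    (∀ (s : Fin S.seedLength → Bool) (x : Fin n → ℤ), (∀ i, |x i| ≤ (m : ℤ)) →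
      ∀ j, |(S.matrix s).mulVec x j| < 2 ^ w) ∧
    ((S.seedLength + S.rows * (w + 1) : ℕ) : ℝ) ≤ b

/-- The probability, over the uniformly random seed, that the estimate on input `x` satisfies
`good`. -/
noncomputable def prob {n : ℕ} (S : LinearSketch n) (x : Fin n → ℤ) (good : ℝ → Prop) : ℝ :=
  ({s : Fin S.seedLength → Bool | good (S.output s x)}.ncard : ℝ) / 2 ^ S.seedLength

end LinearSketch

/-- `sortedEntry x k` is `a_k`, for `1 ≤ k ≤ n`, where `a_1, …, a_n` are the entries of `x`
rearranged in non-increasing order of absolute value (and `0` for `k > n`). -/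
def sortedEntry {n : ℕ} (x : Fin n → ℤ) (k : ℕ) : ℤ :=
  if h : k - 1 < n then x (Tuple.sort (fun i => -|x i|) ⟨k - 1, h⟩) else 0

/-- `‖x_{-k}‖₂²`, where `x_{-k}` is `x` without its top `k` entries in absolute value. -/
noncomputable def tailSq {n : ℕ} (x : Fin n → ℤ) (k : ℕ) : ℝ :=
  ∑ i ∈ Finset.Icc (k + 1) n, (sortedEntry x i : ℝ) ^ 2

/-- `|z|^p`, with the convention `0^0 = 0` of frequency moments (so that `F_0` counts the nonzero
entries). -/
noncomputable def absPow (p : ℝ) (z : ℤ) : ℝ :=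
  if z = 0 then 0 else |(z : ℝ)| ^ p

open Classical in
/-- The `F_p` moment of the entries of absolute value at least `T`. -/
noncomputable def largeMoment {n : ℕ} (p T : ℝ) (x : Fin n → ℤ) : ℝ :=
  ∑ i ∈ Finset.univ.filter (fun i => T ≤ |(x i : ℝ)|), absPow p (x i)

/-- The number of coordinates `i` with `|x i| ∈ [(1 - ε) T, T)`. -/
noncomputable def nearCount {n : ℕ} (ε T : ℝ) (x : Fin n → ℤ) : ℕ :=
  {i : Fin n | |(x i : ℝ)| ∈ Set.Ico ((1 - ε) * T) T}.ncard

/-! Every coordinate gets a uniform sampling value in `{1, …, n}`. Level `l` keeps the coordinates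
with value at most `2 ^ l` and hashes them with random signs into `B` buckets, `R` times
independently. A coordinate is read at the deepest level that contains it, where the fewest others
compete with it.

Soundness needs no assumption on the tail. The error of a readout is the random sign of the
coordinate times a quantity independent of that sign, so with high probability the `R` readouts do
not all lie strictly on one side of the true value (`unifProb_exists_one_sided_le`). If they nearly
agree, the true value is therefore close to each of them (`acceptedWeight_le`), and inconsistent
coordinates are discarded.

Completeness is needed only for sampled coordinates. Let `w` be the `p`-th power of a large
coordinate and `F` the sum of all such powers. Threshold sampling at scale `τ` uses the coordinate
only if its sampling value is at most `n * w / τ`. A fixed other coordinate then collides with it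
with probability `O((w / τ) ^ 2 / B)`. The tail condition and `p ≤ 2` bound the truncated energy of
the collisions by a multiple of `F / w` (`sum_truncated_le`). Summing over the large coordinates,
the failure probability is of order `(F / τ) ^ 2 / B` up to factors polynomial in `log n / ε`, which
is small for `τ` close enough to `F` and `B` polynomial in `log n / ε`
(`unifProb_exists_inaccurate_le`).

Threshold sampling is monotone in the weights. The estimate thus lies between two estimators with
weights determined by `x` alone, to which Chebyshev's inequality applies although the accepted
weights depend on the sampling values. Since `F` is unknown, all dyadic scales are tried and the
estimates themselves select one (`abs_estimate_sub_le`). Finally, Newman's theorem replaces the long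
random string by `O(log n)` bits (`exists_small_sample`). -/

open Finset
open scoped BigOperators

/-! ### Finite probability spaces with the uniform distribution -/

section FiniteProbability

variable {Ω : Type*} [Fintype Ω] {ι : Type*} [Fintype ι] [DecidableEq ι] {α : Type*} [Fintype α]

open Classical in
/-- The probability of an event under the uniform distribution on a finite type. -/
noncomputable def unifProb (P : Ω → Prop) : ℝ := 𝔼 ω, if P ω then (1 : ℝ) else 0

lemma unifProb_le_expect {P : Ω → Prop} {f : Ω → ℝ} (h0 : ∀ ω, 0 ≤ f ω)
    (h : ∀ ω, P ω → 1 ≤ f ω) : unifProb P ≤ 𝔼 ω, f ω := by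
  classical
  refine Finset.expect_le_expect fun ω _ => ?_
  split_ifs with hP
  · exact h ω hP
  · exact h0 ω

lemma unifProb_nonneg (P : Ω → Prop) : 0 ≤ unifProb P := by
  classical
  exact Finset.expect_nonneg fun ω _ => by positivity

lemma unifProb_mono {P Q : Ω → Prop} (h : ∀ ω, P ω → Q ω) : unifProb P ≤ unifProb Q := by
  classical
  refine unifProb_le_expect (fun ω => by positivity) fun ω hω => ?_
  simp [h ω hω]

lemma unifProb_or_le (P Q : Ω → Prop) :
    unifProb (fun ω => P ω ∨ Q ω) ≤ unifProb P + unifProb Q := by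
  classical
  rw [unifProb, unifProb, unifProb, ← Finset.expect_add_distrib]
  refine Finset.expect_le_expect fun ω _ => ?_
  by_cases hP : P ω <;> by_cases hQ : Q ω <;> simp [hP, hQ]

lemma unifProb_exists_le {κ : Type*} (s : Finset κ) (P : κ → Ω → Prop) :
    unifProb (fun ω => ∃ i ∈ s, P i ω) ≤ ∑ i ∈ s, unifProb (P i) := by
  classical
  simp only [unifProb]
  rw [Finset.expect_sum_comm univ s (fun ω i => if P i ω then (1 : ℝ) else 0) |>.symm]
  refine Finset.expect_le_expect fun ω _ => ?_
  split_ifs with h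
  · obtain ⟨i, hi, hP⟩ := h
    calc (1 : ℝ) = if P i ω then (1 : ℝ) else 0 := by simp [hP]
      _ ≤ _ := Finset.single_le_sum (f := fun i => if P i ω then (1 : ℝ) else 0)
          (fun j _ => by positivity) hi
  · exact Finset.sum_nonneg fun j _ => by positivity

lemma unifProb_eq_card_div (P : Ω → Prop) [DecidablePred P] :
    unifProb P = (univ.filter P).card / (Fintype.card Ω : ℝ) := by
  rw [unifProb, Fintype.expect_eq_sum_div_card, ← Finset.sum_boole]
  congr!

lemma unifProb_not [Nonempty Ω] (P : Ω → Prop) : unifProb (fun ω => ¬ P ω) = 1 - unifProb P := by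
  classical
  rw [eq_sub_iff_add_eq, unifProb, unifProb, ← Finset.expect_add_distrib,
    ← Fintype.expect_const (ι := Ω) (1 : ℝ)]
  refine Finset.expect_congr rfl fun ω _ => ?_
  by_cases h : P ω <;> simp [h]

lemma expect_prod_type {β : Type*} [Fintype β] (f : α × β → ℝ) :
    𝔼 x, f x = 𝔼 a, 𝔼 b, f (a, b) := by
  rw [← Finset.univ_product_univ, Finset.expect_product]

lemma unifProb_prod {β : Type*} [Fintype β] (P : α × β → Prop) :
    unifProb P = 𝔼 a, unifProb fun b => P (a, b) := by
  classical
  rw [unifProb, expect_prod_type]; rfl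

lemma unifProb_le_of_forall {β : Type*} [Fintype β] [Nonempty α] {P : α × β → Prop} {c : ℝ}
    (h : ∀ a, unifProb (fun b => P (a, b)) ≤ c) : unifProb P ≤ c := by
  rw [unifProb_prod]
  exact Finset.expect_le univ_nonempty fun a _ => h a

lemma expect_pi_eval [Nonempty α] (i : ι) (f : α → ℝ) :
    𝔼 ω : ι → α, f (ω i) = 𝔼 a, f a := by
  rw [Fintype.expect_equiv (Equiv.funSplitAt i α) (fun ω => f (ω i)) (fun x => f x.1)
    (fun ω => rfl), expect_prod_type]
  exact Finset.expect_congr rfl fun a _ => Fintype.expect_const (f a)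

lemma expect_pi_eval₂ [Nonempty α] {i j : ι} (hij : i ≠ j) (f : α → α → ℝ) :
    𝔼 ω : ι → α, f (ω i) (ω j) = 𝔼 a, 𝔼 b, f a b := by
  rw [Fintype.expect_equiv (Equiv.funSplitAt i α) (fun ω => f (ω i) (ω j))
    (fun x => f x.1 (x.2 ⟨j, hij.symm⟩)) (fun ω => rfl), expect_prod_type]
  exact Finset.expect_congr rfl fun a _ => expect_pi_eval (⟨j, hij.symm⟩ : {k // k ≠ i}) (f a)

lemma expect_sum_sq_of_centered [Nonempty α] (f : ι → α → ℝ) (hf : ∀ i, 𝔼 a, f i a = 0) :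
    𝔼 ω : ι → α, (∑ i, f i (ω i)) ^ 2 = ∑ i, 𝔼 a, f i a ^ 2 := by
  simp_rw [sq, Finset.sum_mul_sum]
  rw [Finset.expect_sum_comm]
  refine Finset.sum_congr rfl fun i _ => ?_
  rw [Finset.expect_sum_comm, Finset.sum_eq_single i]
  · exact expect_pi_eval i fun a => f i a * f i a
  · intro j _ hj
    rw [expect_pi_eval₂ hj.symm (fun a b => f i a * f j b)]
    simp [← Finset.mul_expect, hf j]
  · simp

lemma unifProb_sq_le {f : Ω → ℝ} {c : ℝ} (hc : 0 < c) :
    unifProb (fun ω => c < |f ω|) ≤ (𝔼 ω, f ω ^ 2) / c ^ 2 := by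
  rw [Finset.expect_div]
  refine unifProb_le_expect (fun ω => by positivity) fun ω h => ?_
  rw [one_le_div (by positivity), ← sq_abs (f ω)]
  gcongr

end FiniteProbability

/-! ### Random signs -/

/-- The sign encoded by a bit. -/
def boolSign (b : Bool) : ℤ := if b then 1 else -1

lemma boolSign_mul_self (b : Bool) : boolSign b * boolSign b = 1 := by cases b <;> rfl

lemma boolSign_not (b : Bool) : boolSign (!b) = -boolSign b := by cases b <;> rfl

lemma abs_boolSign (b : Bool) : |boolSign b| = 1 := by cases b <;> rfl

lemma expect_boolSign (c : ℝ) : 𝔼 b, (boolSign b : ℝ) * c = 0 := by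
  rw [Fintype.expect_eq_sum_div_card]; simp [boolSign]

section Signs

variable {ι : Type*} [Fintype ι] [DecidableEq ι]

/-- A truncated Chebyshev inequality for sums with random signs. -/
lemma unifProb_sign_sum_le (J : Finset ι) (x : ι → ℝ) {θ : ℝ} (hθ : 0 < θ) :
    unifProb (fun s : ι → Bool => θ < |∑ j ∈ J, (boolSign (s j) : ℝ) * x j|) ≤
      ∑ j ∈ J, min 1 (x j ^ 2 / θ ^ 2) := by
  -- If one term reaches `θ`, the right-hand side is at least `1` and nothing is to be shown.
  -- Otherwise no truncation is active and the bound is Chebyshev's.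
  by_cases hbig : ∃ j ∈ J, θ ≤ |x j|
  · obtain ⟨j, hj, hx⟩ := hbig
    have h1 : (1 : ℝ) ≤ ∑ j ∈ J, min 1 (x j ^ 2 / θ ^ 2) := by
      refine le_trans ?_ (Finset.single_le_sum (f := fun j => min 1 (x j ^ 2 / θ ^ 2))
        (fun j _ => by positivity) hj)
      refine le_min le_rfl ?_
      rw [one_le_div (by positivity), ← sq_abs (x j)]
      gcongr
    refine le_trans ?_ h1
    classical
    refine Finset.expect_le univ_nonempty fun ω _ => ?_
    split_ifs <;> norm_num
  · push Not at hbig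
    refine (unifProb_sq_le hθ).trans ?_
    have h := expect_sum_sq_of_centered (α := Bool)
      (fun j b => (boolSign b : ℝ) * if j ∈ J then x j else 0) (fun j => expect_boolSign _)
    have e1 : ∀ s : ι → Bool, (∑ j ∈ J, (boolSign (s j) : ℝ) * x j) =
        ∑ j, (boolSign (s j) : ℝ) * if j ∈ J then x j else 0 := by
      intro s
      simp only [mul_ite, mul_zero, Finset.sum_ite_mem, Finset.univ_inter]
    simp_rw [e1, h, Finset.sum_div]
    have e2 : ∀ j, 𝔼 b, ((boolSign b : ℝ) * if j ∈ J then x j else 0) ^ 2 =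
        if j ∈ J then x j ^ 2 else 0 := by
      intro j
      rw [Fintype.expect_eq_sum_div_card]
      by_cases hj : j ∈ J <;> simp [boolSign, hj]
    simp_rw [e2]
    rw [← Finset.sum_div, Finset.sum_ite_mem, Finset.univ_inter, Finset.sum_div]
    refine Finset.sum_le_sum fun j hj => le_min ?_ le_rfl
    rw [div_le_one (by positivity), ← sq_abs (x j)]
    have := hbig j hj
    gcongr

/-- Flipping the sign of one coordinate in all of `R` repetitions: it is unlikely that errors
which change sign with this coordinate are positive in every repetition. -/
lemma unifProb_forall_pos_le {R : ℕ} (i : ι) (X : Fin R → (ι → Bool) → ℤ)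
    (hX : ∀ r s s', (∀ j ≠ i, s j = s' j) → X r s = X r s') :
    unifProb (fun s : Fin R → ι → Bool => ∀ r, 0 < boolSign (s r i) * X r (s r)) ≤
      (1 / 2) ^ R := by
  classical
  rw [unifProb_eq_card_div, div_le_iff₀ (by positivity), one_div, inv_pow, ← div_eq_inv_mul,
    le_div_iff₀ (by positivity)]
  set S := univ.filter fun s : Fin R → ι → Bool => ∀ r, 0 < boolSign (s r i) * X r (s r)
  -- Overwriting the `R` signs of `i` by arbitrary bits is injective on `S`: the remaining signs fix
  -- each `X r`, and positivity then determines the overwritten sign. Hence `S` has density at most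
  -- `2 ^ (-R)`.
  have hinj : (S ×ˢ (univ : Finset (Fin R → Bool))).card ≤
      (univ : Finset (Fin R → ι → Bool)).card := by
    refine Finset.card_le_card_of_injOn
      (fun q r => Function.update (q.1 r) i (q.2 r)) (by simp) ?_
    rintro ⟨s, b⟩ hs ⟨s', b'⟩ hs' heq
    simp only [S, coe_product, Set.mem_prod, mem_coe, mem_filter, mem_univ, true_and,
      coe_univ, Set.mem_univ, and_true] at hs hs'
    have hb : b = b' := by
      funext r
      simpa using congrFun (congrFun heq r) i
    have hoff : ∀ r, ∀ j ≠ i, s r j = s' r j := by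
      intro r j hj
      simpa [Function.update_of_ne hj] using congrFun (congrFun heq r) j
    refine Prod.ext ?_ hb
    funext r j
    by_cases hj : j = i
    · subst hj
      have h1 := hs r
      have h2 := hs' r
      rw [hX r _ _ (hoff r)] at h1
      by_contra hne
      have : s r j = !(s' r j) := by
        cases h : s r j <;> cases h' : s' r j <;> simp_all
      rw [this, boolSign_not] at h1
      linarith
    · exact hoff r j hj
  simp only [Finset.card_product, Finset.card_univ, Fintype.card_fun, Fintype.card_bool,
    Fintype.card_fin] at hinj
  simp only [Fintype.card_fun, Fintype.card_bool, Fintype.card_fin]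
  exact_mod_cast hinj

end Signs

/-! ### Short seeds suffice -/

section ShortSeeds

lemma unifProb_forall_mem_eq {Ω I : Type*} [Fintype Ω] [Nonempty Ω] [Fintype I] [DecidableEq I]
    (Q : Ω → Prop) (D : Finset I) :
    unifProb (fun s : I → Ω => ∀ b ∈ D, Q (s b)) = unifProb Q ^ D.card := by
  classical
  have hset : (univ.filter fun s : I → Ω => ∀ b ∈ D, Q (s b)) =
      Fintype.piFinset fun b => if b ∈ D then univ.filter Q else univ := by
    ext s
    simp only [mem_filter, mem_univ, true_and, Fintype.mem_piFinset]
    refine forall_congr' fun b => ?_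
    by_cases hb : b ∈ D <;> simp [hb]
  rw [unifProb_eq_card_div, hset, Fintype.card_piFinset, unifProb_eq_card_div, div_pow,
    ← Finset.prod_mul_prod_compl D]
  have h1 : ∏ b ∈ D, (if b ∈ D then univ.filter Q else univ).card =
      (univ.filter Q).card ^ D.card := by
    rw [Finset.prod_congr rfl (fun b hb => by rw [if_pos hb]), Finset.prod_const]
  have h2 : ∏ b ∈ Dᶜ, (if b ∈ D then univ.filter Q else univ).card =
      (Fintype.card Ω) ^ Dᶜ.card := by
    rw [Finset.prod_congr rfl (fun b hb => by rw [if_neg (Finset.mem_compl.1 hb)]),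
      Finset.prod_const, Finset.card_univ]
  have hΩ : (0 : ℝ) < Fintype.card Ω := by exact_mod_cast Fintype.card_pos
  rw [h1, h2, Fintype.card_fun, ← Finset.card_add_card_compl D, pow_add]
  push_cast
  field_simp

/-- Newman's theorem: if for every input `x` a uniformly random point of `Ω` is bad with very
small probability, then some family of points of `Ω`, whose size is logarithmic in the number of
inputs, contains only a `δ` fraction of bad points for every input. -/
theorem exists_small_sample {Ω X I : Type*} [Fintype Ω] [Nonempty Ω] [Fintype X] [Fintype I]
    [Nonempty I] (bad : X → Ω → Prop) {δ : ℝ} (hδ : 0 < δ)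
    (hbad : ∀ x, unifProb (bad x) ≤ (1 / 4 : ℝ) ^ (1 / δ))
    (hcard : Fintype.card X < 2 ^ Fintype.card I) :
    ∃ s : I → Ω, ∀ x, unifProb (fun b => bad x (s b)) ≤ δ := by
  classical
  set M := Fintype.card I with hM
  have hM0 : (0 : ℝ) < M := by exact_mod_cast Fintype.card_pos
  have key : ∀ x, unifProb (fun s : I → Ω => δ < unifProb (fun b => bad x (s b))) ≤
      (1 / 2) ^ M := by
    intro x
    -- A bad sample contains a set of at least `δ * M` indices that are all bad. Each such set has
    -- probability at most `(4 ^ (-1 / δ)) ^ (δ * M) = 4 ^ (-M)`, which beats the `2 ^ M` subsets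
    -- and leaves `2 ^ (-M)` for the union over fewer than `2 ^ M` inputs.
    set 𝒟 := (univ : Finset (Finset I)).filter fun D => δ * M ≤ D.card
    have hle : unifProb (fun s : I → Ω => δ < unifProb (fun b => bad x (s b))) ≤
        unifProb (fun s : I → Ω => ∃ D ∈ 𝒟, ∀ b ∈ D, bad x (s b)) := by
      refine unifProb_mono fun s hs => ⟨univ.filter fun b => bad x (s b), ?_, by simp⟩
      rw [unifProb_eq_card_div, lt_div_iff₀ hM0] at hs
      simpa [𝒟] using hs.le
    refine hle.trans ((unifProb_exists_le _ _).trans ?_)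
    have hterm : ∀ D ∈ 𝒟, unifProb (fun s : I → Ω => ∀ b ∈ D, bad x (s b)) ≤ (1 / 4) ^ M := by
      intro D hD
      rw [unifProb_forall_mem_eq]
      have hD' : δ * M ≤ D.card := by simpa [𝒟] using hD
      calc unifProb (bad x) ^ D.card ≤ ((1 / 4 : ℝ) ^ (1 / δ)) ^ D.card :=
            pow_le_pow_left₀ (unifProb_nonneg _) (hbad x) _
        _ = (1 / 4 : ℝ) ^ (1 / δ * D.card) := by
            rw [← Real.rpow_natCast, ← Real.rpow_mul (by norm_num)]
        _ ≤ (1 / 4 : ℝ) ^ (M : ℝ) := by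
            refine Real.rpow_le_rpow_of_exponent_ge (by norm_num) (by norm_num) ?_
            rw [one_div, ← div_eq_inv_mul, le_div_iff₀ hδ]
            linarith
        _ = _ := Real.rpow_natCast _ _
    refine (Finset.sum_le_card_nsmul _ _ _ hterm).trans ?_
    have hc : (𝒟.card : ℝ) ≤ 2 ^ M := by
      have := Finset.card_le_univ 𝒟
      rw [Fintype.card_finset] at this
      exact_mod_cast this
    rw [nsmul_eq_mul]
    calc (𝒟.card : ℝ) * (1 / 4) ^ M ≤ 2 ^ M * (1 / 4) ^ M := by gcongr
      _ = _ := by rw [← mul_pow]; norm_num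
  by_contra hno
  push Not at hno
  have h1 : (1 : ℝ) ≤ ∑ x : X,
      unifProb (fun s : I → Ω => δ < unifProb (fun b => bad x (s b))) := by
    refine le_trans ?_ (unifProb_exists_le univ _)
    have : unifProb (fun s : I → Ω => ∃ x ∈ (univ : Finset X),
        δ < unifProb (fun b => bad x (s b))) = 1 := by
      refine (Finset.expect_congr rfl fun s _ => ?_).trans (Fintype.expect_const (1 : ℝ))
      obtain ⟨x, hx⟩ := hno s
      have hs : ∃ x ∈ (univ : Finset X), δ < unifProb (fun b => bad x (s b)) :=
        ⟨x, mem_univ _, hx⟩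
      simp only [hs, if_true]
    exact this.ge
  have h2 := Finset.sum_le_card_nsmul univ _ _ fun x _ => key x
  rw [nsmul_eq_mul, Finset.card_univ] at h2
  have h3 : (Fintype.card X : ℝ) * (1 / 2) ^ M < 2 ^ M * (1 / 2) ^ M := by
    have : (Fintype.card X : ℝ) < 2 ^ M := by exact_mod_cast hcard
    gcongr
  rw [← mul_pow] at h3
  norm_num at h3
  norm_num at h2
  linarith

end ShortSeeds

/-! ### Sketches from families of matrices -/

/-- The integer vectors of dimension `n` with entries bounded by `m`. -/
def BoundedVector (n m : ℕ) : Type := Fin n → Set.Icc (-(m : ℤ)) m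

noncomputable instance (n m : ℕ) : Fintype (BoundedVector n m) :=
  inferInstanceAs (Fintype (Fin n → Set.Icc (-(m : ℤ)) m))

lemma card_boundedVector (n m : ℕ) : Fintype.card (BoundedVector n m) = (2 * m + 1) ^ n := by
  have : Fintype.card (BoundedVector n m) =
      Fintype.card (Fin n → Set.Icc (-(m : ℤ)) m) := rfl
  rw [this, Fintype.card_fun, Fintype.card_fin]
  congr 1
  simp
  omega

/-- A randomized linear sketch with an arbitrary finite space of random strings, whose failure
probability is small, gives one with a random string of `q` bits, as soon as `2 ^ q` exceeds the
logarithm of the number of inputs. -/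
theorem exists_linearSketch {Ω ρ : Type*} [Fintype Ω] [Nonempty Ω] [Fintype ρ] {n m q w : ℕ}
    (A : Ω → Matrix ρ (Fin n) ℤ) (decode : Ω → (ρ → ℤ) → ℝ) {δ : ℝ} (hδ : 0 < δ)
    (hq : (2 * m + 1) ^ n < 2 ^ 2 ^ q)
    (hw : ∀ ω (x : Fin n → ℤ), (∀ i, |x i| ≤ (m : ℤ)) → ∀ j, |(A ω).mulVec x j| < 2 ^ w)
    (good : (Fin n → ℤ) → ℝ → Prop) (promise : (Fin n → ℤ) → Prop)
    (hgood : ∀ x : Fin n → ℤ, (∀ i, |x i| ≤ (m : ℤ)) → promise x →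
      unifProb (fun ω => ¬ good x (decode ω ((A ω).mulVec x))) ≤ (1 / 4 : ℝ) ^ (1 / δ)) :
    ∃ S : LinearSketch n, S.UsesBits m ((q + Fintype.card ρ * (w + 1) : ℕ) : ℝ) ∧
      ∀ x : Fin n → ℤ, (∀ i, |x i| ≤ (m : ℤ)) → promise x → 1 - δ ≤ S.prob x (good x) := by
  classical
  obtain ⟨s, hs⟩ := exists_small_sample (Ω := Ω) (X := BoundedVector n m) (I := Fin q → Bool)
    (fun x ω => promise (fun i => (x i).1) ∧
      ¬ good (fun i => (x i).1) (decode ω ((A ω).mulVec fun i => (x i).1))) hδ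
    (by
      intro x
      by_cases hp : promise (fun i => (x i).1)
      · refine (unifProb_mono fun ω h => h.2).trans (hgood _ (fun i => ?_) hp)
        exact abs_le.2 (x i).2
      · refine (unifProb_mono (Q := fun _ => False) fun ω h => hp h.1).trans ?_
        simp only [unifProb, if_false, Finset.expect_const_zero]
        positivity)
    (by simpa [card_boundedVector] using hq)
  let e := Fintype.equivFin ρ
  refine ⟨⟨q, Fintype.card ρ, fun b => (A (s b)).submatrix e.symm id,
    fun b y => decode (s b) fun r => y (e r)⟩, ⟨w, ?_, le_rfl⟩, ?_⟩
  · intro b x hx j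
    exact hw (s b) x hx (e.symm j)
  · intro x hx hp
    have h := hs (fun i => ⟨x i, abs_le.1 (hx i)⟩)
    simp only [hp, true_and] at h
    rw [unifProb_not] at h
    have hout : ∀ b, decode (s b)
        (fun r => ((A (s b)).submatrix e.symm id).mulVec x (e r)) =
        decode (s b) ((A (s b)).mulVec x) := by
      intro b
      congr 1
      funext r
      simp [Matrix.mulVec, dotProduct]
    have hprob : LinearSketch.prob ⟨q, Fintype.card ρ, fun b => (A (s b)).submatrix e.symm id,
        fun b y => decode (s b) fun r => y (e r)⟩ x (good x) =
        unifProb fun b => good x (decode (s b) ((A (s b)).mulVec x)) := by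
      rw [unifProb_eq_card_div, LinearSketch.prob]
      simp only [LinearSketch.output, hout]
      rw [Set.ncard_eq_toFinset_card']
      simp
    rw [hprob]
    linarith

/-! ### The sketching matrix -/

section Sketch

/-- The randomness of the sketch: a sampling value for each coordinate, and `R` pairs of hash
functions into `B` buckets and sign functions. -/
abbrev SketchSeed (n R B : ℕ) : Type :=
  (Fin n → Fin n) × (Fin R → Fin n → Fin B) × (Fin R → Fin n → Bool)

/-- The rows of the sketch: sampling level, repetition, bucket. -/
abbrev SketchRow (n R B : ℕ) : Type := Fin (Nat.clog 2 n + 1) × Fin R × Fin B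

variable {n R B : ℕ}

/-- At level `l` the coordinates with sampling value at most `2 ^ l` are hashed into buckets. -/
def sketchMatrix (ω : SketchSeed n R B) : Matrix (SketchRow n R B) (Fin n) ℤ :=
  Matrix.of fun q j => if (ω.1 j : ℕ) + 1 ≤ 2 ^ (q.1 : ℕ) ∧ ω.2.1 q.2.1 j = q.2.2 then
    boolSign (ω.2.2 q.2.1 j) else 0

/-- The deepest level at which a coordinate is sampled. -/
def deepestLevel (t : Fin n → Fin n) (i : Fin n) : Fin (Nat.clog 2 n + 1) :=
  ⟨Nat.clog 2 ((t i : ℕ) + 1), Nat.lt_succ_of_le (Nat.clog_mono_right 2 (t i).2)⟩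

/-- The estimate of the coordinate `i` by repetition `r`. -/
def readout (ω : SketchSeed n R B) (y : SketchRow n R B → ℤ) (i : Fin n) (r : Fin R) : ℤ :=
  boolSign (ω.2.2 r i) * y (deepestLevel ω.1 i, r, ω.2.1 r i)

/-- The coordinates in the bucket of `i` at the deepest level of `i`. -/
def collisions (t : Fin n → Fin n) (g : Fin n → Fin B) (i : Fin n) : Finset (Fin n) :=
  univ.filter fun j => j ≠ i ∧ (t j : ℕ) + 1 ≤ 2 ^ Nat.clog 2 ((t i : ℕ) + 1) ∧ g j = g i

/-- The total contribution of the colliding coordinates. -/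
def collisionSum (t : Fin n → Fin n) (g : Fin n → Fin B) (x : Fin n → ℤ) (i : Fin n)
    (s : Fin n → Bool) : ℤ :=
  ∑ j ∈ collisions t g i, boolSign (s j) * x j

lemma readout_eq (ω : SketchSeed n R B) (x : Fin n → ℤ) (i : Fin n) (r : Fin R) :
    readout ω ((sketchMatrix ω).mulVec x) i r =
      x i + boolSign (ω.2.2 r i) * collisionSum ω.1 (ω.2.1 r) x i (ω.2.2 r) := by
  have h : (sketchMatrix ω).mulVec x (deepestLevel ω.1 i, r, ω.2.1 r i) =
      boolSign (ω.2.2 r i) * x i + collisionSum ω.1 (ω.2.1 r) x i (ω.2.2 r) := by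
    simp only [Matrix.mulVec, dotProduct, sketchMatrix, Matrix.of_apply, deepestLevel, ite_mul,
      zero_mul]
    rw [← Finset.add_sum_erase _ _ (mem_univ i), if_pos ⟨Nat.le_pow_clog one_lt_two _, rfl⟩,
      collisionSum, ← Finset.sum_filter]
    congr 2
    ext j
    simp [collisions]
  rw [readout, h, mul_add, ← mul_assoc, boolSign_mul_self, one_mul]

lemma abs_sketch_le {m : ℕ} (ω : SketchSeed n R B) (x : Fin n → ℤ) (hx : ∀ i, |x i| ≤ (m : ℤ))
    (q : SketchRow n R B) : |(sketchMatrix ω).mulVec x q| ≤ n * m := by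
  rw [Matrix.mulVec, dotProduct]
  refine (Finset.abs_sum_le_sum_abs _ _).trans ?_
  have h : ∀ j ∈ (univ : Finset (Fin n)), |sketchMatrix ω q j * x j| ≤ (m : ℤ) := by
    intro j _
    rw [abs_mul]
    have h1 : |sketchMatrix ω q j| ≤ 1 := by
      rw [sketchMatrix, Matrix.of_apply]
      split_ifs
      · exact (abs_boolSign _).le
      · simp
    calc |sketchMatrix ω q j| * |x j| ≤ 1 * |x j| := by gcongr
      _ ≤ m := by simpa using hx j
  simpa using Finset.sum_le_card_nsmul _ _ _ h

/-! ### Soundness: the readouts straddle the true value -/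

/-- Once sampling values and hashes are fixed, the collision sum of `i` does not involve the sign of
`i`, so the sign-flipping bound applies to positive and to negative errors. The size of the
collisions is irrelevant. -/
lemma unifProb_exists_one_sided_le [NeZero n] [NeZero B] (x : Fin n → ℤ) :
    unifProb (fun ω : SketchSeed n R B => ∃ i ∈ (univ : Finset (Fin n)),
      (∀ r, x i < readout ω ((sketchMatrix ω).mulVec x) i r) ∨
      (∀ r, readout ω ((sketchMatrix ω).mulVec x) i r < x i)) ≤
      n * (2 * (1 / 2) ^ R) := by
  refine (unifProb_exists_le _ _).trans ?_
  have h : ∀ i ∈ (univ : Finset (Fin n)), unifProb (fun ω : SketchSeed n R B =>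
      (∀ r, x i < readout ω ((sketchMatrix ω).mulVec x) i r) ∨
      (∀ r, readout ω ((sketchMatrix ω).mulVec x) i r < x i)) ≤ 2 * (1 / 2) ^ R := by
    intro i _
    refine (unifProb_or_le _ _).trans ?_
    rw [two_mul]
    have hdep : ∀ (t : Fin n → Fin n) (g : Fin n → Fin B) (s s' : Fin n → Bool),
        (∀ j ≠ i, s j = s' j) → collisionSum t g x i s = collisionSum t g x i s' := by
      intro t g s s' h
      refine Finset.sum_congr rfl fun j hj => ?_
      rw [h j (by simp only [collisions, mem_filter] at hj; exact hj.2.1)]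
    refine add_le_add ?_ ?_
    · refine unifProb_le_of_forall fun t => unifProb_le_of_forall fun h => ?_
      refine (unifProb_mono fun σ hσ r => ?_).trans
        (unifProb_forall_pos_le i (fun r s => collisionSum t (h r) x i s)
          (fun r s s' => hdep t (h r) s s'))
      have := hσ r
      rw [readout_eq] at this
      simpa using this
    · refine unifProb_le_of_forall fun t => unifProb_le_of_forall fun h => ?_
      refine (unifProb_mono fun σ hσ r => ?_).trans
        (unifProb_forall_pos_le i (fun r s => -collisionSum t (h r) x i s)
          (fun r s s' hs => by rw [hdep t (h r) s s' hs]))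
      have := hσ r
      rw [readout_eq] at this
      simp only at this ⊢
      linarith
  simpa using Finset.sum_le_card_nsmul _ _ _ h

/-! ### Completeness: large coordinates are read accurately -/

lemma card_fin_filter_succ_le (n : ℕ) {z : ℝ} (hz : 0 ≤ z) :
    (univ.filter fun u : Fin n => ((u : ℕ) : ℝ) + 1 ≤ z).card = min n ⌊z⌋₊ := by
  have : (univ.filter fun u : Fin n => ((u : ℕ) : ℝ) + 1 ≤ z) =
      univ.filter fun u : Fin n => (u : ℕ) < ⌊z⌋₊ := by
    ext u
    simp only [mem_filter, mem_univ, true_and]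
    rw [← Nat.succ_le_iff, Nat.le_floor_iff hz]
    push_cast
    rfl
  rw [this, Fin.card_filter_val_lt]

lemma expect_fin_indicator (n : ℕ) {z : ℝ} (hz : 0 ≤ z) :
    𝔼 u : Fin n, (if ((u : ℕ) : ℝ) + 1 ≤ z then (1 : ℝ) else 0) = (min n ⌊z⌋₊ : ℕ) / n := by
  rw [Fintype.expect_eq_sum_div_card, Finset.sum_boole, card_fin_filter_succ_le n hz,
    Fintype.card_fin]

lemma expect_fin_indicator_le (n : ℕ) {z : ℝ} (hz : 0 ≤ z) :
    𝔼 u : Fin n, (if ((u : ℕ) : ℝ) + 1 ≤ z then (1 : ℝ) else 0) ≤ z / n := by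
  rw [expect_fin_indicator n hz]
  gcongr
  exact (Nat.cast_le.2 (min_le_right _ _)).trans (Nat.floor_le hz)

lemma two_pow_clog_le (u : ℕ) : 2 ^ Nat.clog 2 (u + 1) ≤ 2 * (u + 1) := by
  rcases Nat.eq_zero_or_pos u with rfl | hu
  · simp
  · have h := Nat.pow_pred_clog_lt_self one_lt_two (show 1 < u + 1 by omega)
    have hpos : 0 < Nat.clog 2 (u + 1) := Nat.clog_pos one_lt_two (by omega)
    obtain ⟨m, hm⟩ := Nat.exists_eq_succ_of_ne_zero hpos.ne'
    rw [hm] at h ⊢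
    rw [pow_succ]
    simp only [Nat.pred_succ] at h
    omega

/-- The first event has probability at most `a`. Given it, rounding to a power of two at most
doubles the value, so the second has probability at most `2 * (u + 1) / n ≤ 2 * a`. -/
lemma expect_sampled_collision_le [NeZero n] {a : ℝ} (ha : 0 ≤ a) :
    𝔼 u : Fin n, 𝔼 v : Fin n, ((if ((u : ℕ) : ℝ) + 1 ≤ n * a then (1 : ℝ) else 0) *
      if (v : ℕ) + 1 ≤ 2 ^ Nat.clog 2 ((u : ℕ) + 1) then (1 : ℝ) else 0) ≤ 2 * a ^ 2 := by
  have hn : (0 : ℝ) < n := by exact_mod_cast Nat.pos_of_ne_zero (NeZero.ne n)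
  have h1 : ∀ u : Fin n, 𝔼 v : Fin n, ((if ((u : ℕ) : ℝ) + 1 ≤ n * a then (1 : ℝ) else 0) *
      if (v : ℕ) + 1 ≤ 2 ^ Nat.clog 2 ((u : ℕ) + 1) then (1 : ℝ) else 0) ≤
      (if ((u : ℕ) : ℝ) + 1 ≤ n * a then (1 : ℝ) else 0) * (2 * a) := by
    intro u
    rw [← Finset.mul_expect]
    split_ifs with h
    · rw [one_mul, one_mul]
      have h2 := expect_fin_indicator_le n (z := (2 : ℝ) ^ Nat.clog 2 ((u : ℕ) + 1))
        (by positivity)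
      have h3 : ((2 : ℝ) ^ Nat.clog 2 ((u : ℕ) + 1)) ≤ 2 * (((u : ℕ) : ℝ) + 1) := by
        exact_mod_cast two_pow_clog_le u
      have h4 : ∀ v : Fin n, (((v : ℕ) : ℝ) + 1 ≤ (2 : ℝ) ^ Nat.clog 2 ((u : ℕ) + 1)) ↔
          (v : ℕ) + 1 ≤ 2 ^ Nat.clog 2 ((u : ℕ) + 1) := fun v => by exact_mod_cast Iff.rfl
      simp only [h4] at h2
      refine h2.trans ?_
      rw [div_le_iff₀ hn]
      linarith
    · simp
  refine (Finset.expect_le_expect fun u _ => h1 u).trans ?_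
  rw [← Finset.expect_mul]
  have h5 := expect_fin_indicator_le n (z := n * a) (by positivity)
  rw [mul_div_cancel_left₀ _ hn.ne'] at h5
  nlinarith

lemma expect_hash_collision [NeZero B] {i j : Fin n} (hij : j ≠ i) (r : Fin R) :
    𝔼 h : Fin R → Fin n → Fin B, (if h r j = h r i then (1 : ℝ) else 0) = 1 / B := by
  rw [expect_pi_eval r fun g : Fin n → Fin B => if g j = g i then (1 : ℝ) else 0,
    expect_pi_eval₂ hij fun a b : Fin B => if a = b then (1 : ℝ) else 0]
  simp

/-- The probability that the coordinate `i` has a small sampling value and is read inaccurately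
by repetition `r`. -/
lemma unifProb_inaccurate_le [NeZero n] [NeZero B] (x : Fin n → ℤ) (i : Fin n) (r : Fin R)
    {θ a : ℝ} (hθ : 0 < θ) (ha : 0 ≤ a) :
    unifProb (fun ω : SketchSeed n R B => ((ω.1 i : ℕ) : ℝ) + 1 ≤ n * a ∧
      θ < |(readout ω ((sketchMatrix ω).mulVec x) i r : ℝ) - x i|) ≤
      2 * a ^ 2 / B * ∑ j, min 1 ((x j : ℝ) ^ 2 / θ ^ 2) := by
  classical
  have hsign : ∀ (t : Fin n → Fin n) (h : Fin R → Fin n → Fin B),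
      unifProb (fun σ : Fin R → Fin n → Bool => ((t i : ℕ) : ℝ) + 1 ≤ n * a ∧
        θ < |(readout (t, h, σ) ((sketchMatrix (t, h, σ)).mulVec x) i r : ℝ) - x i|) ≤
      ∑ j ∈ univ.erase i, (((if ((t i : ℕ) : ℝ) + 1 ≤ n * a then (1 : ℝ) else 0) *
        if (t j : ℕ) + 1 ≤ 2 ^ Nat.clog 2 ((t i : ℕ) + 1) then (1 : ℝ) else 0) *
        if h r j = h r i then (1 : ℝ) else 0) * min 1 ((x j : ℝ) ^ 2 / θ ^ 2) := by
    intro t h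
    by_cases hti : ((t i : ℕ) : ℝ) + 1 ≤ n * a
    · have h1 := unifProb_sign_sum_le (collisions t (h r) i) (fun j => (x j : ℝ)) hθ
      have h2 := expect_pi_eval (α := Fin n → Bool) r (fun s => if θ < |∑ j ∈ collisions t (h r) i,
        (boolSign (s j) : ℝ) * x j| then (1 : ℝ) else 0)
      have h3 : ∀ σ : Fin R → Fin n → Bool,
          |(readout (t, h, σ) ((sketchMatrix (t, h, σ)).mulVec x) i r : ℝ) - x i| =
          |∑ j ∈ collisions t (h r) i, (boolSign (σ r j) : ℝ) * x j| := by
        intro σ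
        rw [readout_eq]
        push_cast
        have habs : |(boolSign (σ r i) : ℝ)| = 1 := by
          rw [← Int.cast_abs, abs_boolSign, Int.cast_one]
        rw [add_sub_cancel_left, abs_mul, habs, one_mul, collisionSum]
        push_cast
        rfl
      have h4 : unifProb (fun σ : Fin R → Fin n → Bool => ((t i : ℕ) : ℝ) + 1 ≤ n * a ∧
          θ < |(readout (t, h, σ) ((sketchMatrix (t, h, σ)).mulVec x) i r : ℝ) - x i|) =
          unifProb fun s : Fin n → Bool =>
            θ < |∑ j ∈ collisions t (h r) i, (boolSign (s j) : ℝ) * x j| := by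
        simp only [h3, hti, true_and]
        exact h2
      rw [h4]
      refine h1.trans (le_of_eq ?_)
      rw [collisions, Finset.sum_filter, ← Finset.add_sum_erase _ _ (mem_univ i)]
      simp only [ne_eq, not_true_eq_false, false_and, if_false, zero_add]
      refine Finset.sum_congr rfl fun j hj => ?_
      have hj' : j ≠ i := by simpa using hj
      by_cases hc : (t j : ℕ) + 1 ≤ 2 ^ Nat.clog 2 ((t i : ℕ) + 1) <;>
        by_cases hh : h r j = h r i <;> simp [hj', hti, hc, hh]
    · refine (unifProb_mono (Q := fun _ => False) fun σ hσ => hti hσ.1).trans ?_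
      simp [unifProb, hti]
  rw [unifProb_prod]
  have hle : ∀ t : Fin n → Fin n, unifProb (fun q : (Fin R → Fin n → Fin B) × _ =>
      ((t i : ℕ) : ℝ) + 1 ≤ n * a ∧
        θ < |(readout (t, q) ((sketchMatrix (t, q)).mulVec x) i r : ℝ) - x i|) ≤
      ∑ j ∈ univ.erase i, (((if ((t i : ℕ) : ℝ) + 1 ≤ n * a then (1 : ℝ) else 0) *
        if (t j : ℕ) + 1 ≤ 2 ^ Nat.clog 2 ((t i : ℕ) + 1) then (1 : ℝ) else 0) *
        (1 / B)) * min 1 ((x j : ℝ) ^ 2 / θ ^ 2) := by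
    intro t
    rw [unifProb_prod]
    refine (Finset.expect_le_expect fun h _ => hsign t h).trans (le_of_eq ?_)
    rw [Finset.expect_sum_comm]
    refine Finset.sum_congr rfl fun j hj => ?_
    rw [← Finset.expect_mul, ← Finset.mul_expect,
      expect_hash_collision (by simpa using hj) r]
  refine (Finset.expect_le_expect fun t _ => hle t).trans ?_
  rw [Finset.expect_sum_comm, Finset.mul_sum, ← Finset.add_sum_erase _ _ (mem_univ i)]
  have hterm : ∀ j ∈ univ.erase i,
      𝔼 t : Fin n → Fin n, (((if ((t i : ℕ) : ℝ) + 1 ≤ n * a then (1 : ℝ) else 0) *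
        if (t j : ℕ) + 1 ≤ 2 ^ Nat.clog 2 ((t i : ℕ) + 1) then (1 : ℝ) else 0) *
        (1 / B)) * min 1 ((x j : ℝ) ^ 2 / θ ^ 2) ≤
      2 * a ^ 2 / B * min 1 ((x j : ℝ) ^ 2 / θ ^ 2) := by
    intro j hj
    have hj' : i ≠ j := by simpa [eq_comm] using hj
    rw [← Finset.expect_mul, ← Finset.expect_mul,
      expect_pi_eval₂ hj' fun u v : Fin n => (if ((u : ℕ) : ℝ) + 1 ≤ n * a then (1 : ℝ) else 0) *
        if (v : ℕ) + 1 ≤ 2 ^ Nat.clog 2 ((u : ℕ) + 1) then (1 : ℝ) else 0,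
      mul_one_div]
    gcongr
    exact expect_sampled_collision_le ha
  refine (Finset.sum_le_sum hterm).trans (le_add_of_nonneg_left ?_)
  positivity

end Sketch

/-! ### Threshold sampling -/

section ThresholdSampling

/-- The contribution of a coordinate of weight `w` and sampling value `t ∈ {1, …, n}` to the
threshold sampling estimator: with probability about `min 1 (w / τ)` it is `max w τ`. -/
noncomputable def thresholdSample (n : ℕ) (τ w t : ℝ) : ℝ := if τ * t ≤ n * w then max w τ else 0

variable {n : ℕ} {τ : ℝ}

lemma thresholdSample_nonneg (hτ : 0 < τ) (w t : ℝ) : 0 ≤ thresholdSample n τ w t := by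
  rw [thresholdSample]
  split_ifs
  · exact hτ.le.trans (le_max_right _ _)
  · exact le_rfl

/-- Because this holds pointwise in `t`, bounds on the weights transfer to the estimator even when
the weights are correlated with the sampling values. -/
lemma thresholdSample_mono (hτ : 0 < τ) {w w' : ℝ} (hw : w ≤ w') (t : ℝ) :
    thresholdSample n τ w t ≤ thresholdSample n τ w' t := by
  by_cases h : τ * t ≤ n * w
  · have h' : τ * t ≤ n * w' := h.trans (by gcongr)
    rw [thresholdSample, thresholdSample, if_pos h, if_pos h']
    exact max_le_max_right _ hw
  · rw [thresholdSample, if_neg h]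
    exact thresholdSample_nonneg hτ _ _

lemma thresholdSample_zero (hτ : 0 < τ) {t : ℝ} (ht : 0 < t) : thresholdSample n τ 0 t = 0 := by
  rw [thresholdSample, if_neg]
  have : 0 < τ * t := by positivity
  simpa using this

lemma thresholdSample_of_le (hτ : 0 < τ) {w : ℝ} (hw : τ ≤ w) (u : Fin n) :
    thresholdSample n τ w ((u : ℕ) + 1) = w := by
  have hw0 : 0 ≤ w := hτ.le.trans hw
  rw [thresholdSample, if_pos, max_eq_left hw]
  have h : ((u : ℕ) : ℝ) + 1 ≤ n := by exact_mod_cast u.2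
  calc τ * (((u : ℕ) : ℝ) + 1) ≤ w * n := by gcongr
    _ = n * w := mul_comm _ _

lemma thresholdSample_of_lt (hτ : 0 < τ) {w : ℝ} (hw : w < τ) (t : ℝ) :
    thresholdSample n τ w t = τ * if t ≤ n * (w / τ) then (1 : ℝ) else 0 := by
  have : τ * t ≤ n * w ↔ t ≤ n * (w / τ) := by
    rw [← mul_div_assoc, le_div_iff₀ hτ, mul_comm]
  simp only [thresholdSample, this, max_eq_right hw.le, mul_ite, mul_one, mul_zero]

variable [NeZero n]

lemma expect_thresholdSample_le (hτ : 0 < τ) {w : ℝ} (hw : 0 ≤ w) :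
    𝔼 u : Fin n, thresholdSample n τ w ((u : ℕ) + 1) ≤ w := by
  rcases le_or_gt τ w with h | h
  · simp_rw [thresholdSample_of_le hτ h]
    exact (Fintype.expect_const w).le
  · simp_rw [thresholdSample_of_lt hτ h]
    rw [← Finset.mul_expect]
    have hn : (0 : ℝ) < n := by exact_mod_cast Nat.pos_of_ne_zero (NeZero.ne n)
    have h1 := expect_fin_indicator_le n (z := n * (w / τ)) (by positivity)
    rw [mul_div_cancel_left₀ _ hn.ne', le_div_iff₀ hτ] at h1
    linarith

/-- The loss `τ / n` is the rounding error from having only `n` sampling values; over all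
coordinates it adds up to `τ`. -/
lemma le_expect_thresholdSample (hτ : 0 < τ) {w : ℝ} (hw : 0 ≤ w) :
    w - τ / n ≤ 𝔼 u : Fin n, thresholdSample n τ w ((u : ℕ) + 1) := by
  have hn : (0 : ℝ) < n := by exact_mod_cast Nat.pos_of_ne_zero (NeZero.ne n)
  rcases le_or_gt τ w with h | h
  · simp_rw [thresholdSample_of_le hτ h]
    rw [Fintype.expect_const w]
    linarith [div_pos hτ hn]
  · simp_rw [thresholdSample_of_lt hτ h]
    rw [← Finset.mul_expect, expect_fin_indicator n (z := n * (w / τ)) (by positivity)]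
    have hz : n * (w / τ) ≤ n := by
      rw [← mul_div_assoc, div_le_iff₀ hτ]
      gcongr
    have h1 : ⌊n * (w / τ)⌋₊ ≤ n := by
      have := Nat.floor_le_floor hz
      rwa [Nat.floor_natCast] at this
    rw [min_eq_right h1]
    have h2 := Nat.lt_floor_add_one (n * (w / τ))
    rw [← mul_div_assoc, le_div_iff₀ hn, sub_mul, div_mul_cancel₀ _ hn.ne']
    have h3 : τ * (n * (w / τ)) = w * n := by field_simp
    nlinarith

lemma expect_thresholdSample_variance_le (hτ : 0 < τ) {w : ℝ} (hw : 0 ≤ w) :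
    𝔼 u : Fin n, (thresholdSample n τ w ((u : ℕ) + 1) -
      𝔼 v : Fin n, thresholdSample n τ w ((v : ℕ) + 1)) ^ 2 ≤ τ * w := by
  rcases le_or_gt τ w with h | h
  · simp_rw [thresholdSample_of_le hτ h]
    rw [Fintype.expect_const w]
    simp only [sub_self, ne_eq, OfNat.ofNat_ne_zero, not_false_eq_true, zero_pow,
      Finset.expect_const_zero]
    positivity
  · have hle := expect_thresholdSample_le (n := n) hτ hw
    set μ := 𝔼 v : Fin n, thresholdSample n τ w ((v : ℕ) + 1) with hμ
    have hμ0 : 0 ≤ μ := Finset.expect_nonneg fun v _ => thresholdSample_nonneg hτ _ _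
    -- Below the scale the sample takes only the values `0` and `τ`, so its square is `τ` times
    -- itself and the variance is `τ * μ - μ ^ 2`.
    have h1 : ∀ u : Fin n, (thresholdSample n τ w ((u : ℕ) + 1) - μ) ^ 2 =
        (τ - 2 * μ) * thresholdSample n τ w ((u : ℕ) + 1) + μ ^ 2 := by
      intro u
      rw [thresholdSample_of_lt hτ h]
      split_ifs <;> ring
    simp_rw [h1]
    rw [Finset.expect_add_distrib, ← Finset.mul_expect, Fintype.expect_const (μ ^ 2), ← hμ]
    nlinarith

/-- Concentration of the threshold sampling estimator. -/
lemma unifProb_thresholdSample_deviation_le (hτ : 0 < τ) {w : Fin n → ℝ} (hw : ∀ i, 0 ≤ w i)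
    {c : ℝ} (hc : 0 < c) :
    unifProb (fun t : Fin n → Fin n => c < |∑ i, (thresholdSample n τ (w i) ((t i : ℕ) + 1) -
      𝔼 v : Fin n, thresholdSample n τ (w i) ((v : ℕ) + 1))|) ≤ τ * (∑ i, w i) / c ^ 2 := by
  refine (unifProb_sq_le hc).trans ?_
  have h := expect_sum_sq_of_centered (ι := Fin n) (α := Fin n)
    (fun i u => thresholdSample n τ (w i) ((u : ℕ) + 1) -
      𝔼 v : Fin n, thresholdSample n τ (w i) ((v : ℕ) + 1))
    (fun i => by rw [Finset.expect_sub_distrib, Fintype.expect_const, sub_self])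
  rw [h, Finset.mul_sum]
  gcongr with i _
  exact expect_thresholdSample_variance_le hτ (hw i)

lemma unifProb_thresholdSample_gt_le (hτ : 0 < τ) {w : Fin n → ℝ} (hw : ∀ i, 0 ≤ w i)
    {c : ℝ} (hc : 0 < c) :
    unifProb (fun t : Fin n → Fin n =>
      ∑ i, w i + c < ∑ i, thresholdSample n τ (w i) ((t i : ℕ) + 1)) ≤
      τ * (∑ i, w i) / c ^ 2 := by
  refine (unifProb_mono fun t ht => ?_).trans (unifProb_thresholdSample_deviation_le hτ hw hc)
  rw [Finset.sum_sub_distrib]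
  have : ∑ i, 𝔼 v : Fin n, thresholdSample n τ (w i) ((v : ℕ) + 1) ≤ ∑ i, w i :=
    Finset.sum_le_sum fun i _ => expect_thresholdSample_le hτ (hw i)
  exact lt_of_lt_of_le (by linarith) (le_abs_self _)

lemma unifProb_thresholdSample_lt_le (hτ : 0 < τ) {w : Fin n → ℝ} (hw : ∀ i, 0 ≤ w i)
    {c : ℝ} (hc : 0 < c) :
    unifProb (fun t : Fin n → Fin n =>
      ∑ i, thresholdSample n τ (w i) ((t i : ℕ) + 1) < ∑ i, w i - τ - c) ≤
      τ * (∑ i, w i) / c ^ 2 := by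
  refine (unifProb_mono fun t ht => ?_).trans (unifProb_thresholdSample_deviation_le hτ hw hc)
  rw [Finset.sum_sub_distrib]
  have hn : (0 : ℝ) < n := by exact_mod_cast Nat.pos_of_ne_zero (NeZero.ne n)
  have h1 : ∑ i, (w i - τ / n) ≤
      ∑ i, 𝔼 v : Fin n, thresholdSample n τ (w i) ((v : ℕ) + 1) :=
    Finset.sum_le_sum fun i _ => le_expect_thresholdSample hτ (hw i)
  rw [Finset.sum_sub_distrib, Finset.sum_const, Finset.card_univ, Fintype.card_fin,
    nsmul_eq_mul, mul_div_cancel₀ _ hn.ne'] at h1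
  exact lt_of_lt_of_le (by linarith) (neg_le_abs _)

end ThresholdSampling

/-! ### Accepting a coordinate -/

section Accept

variable {R : ℕ} [NeZero R]

lemma absPow_of_ne {p : ℝ} {z : ℤ} (hz : z ≠ 0) : absPow p z = |(z : ℝ)| ^ p := if_neg hz

lemma absPow_nonneg (p : ℝ) (z : ℤ) : 0 ≤ absPow p z := by
  rw [absPow]; split_ifs <;> positivity

/-- The weight assigned to a coordinate with readouts `y`; it is zero unless the readouts agree up
to a factor `1 ± β` and are not too small compared to the threshold `T`. -/
noncomputable def acceptedWeight (β p T : ℝ) (y : Fin R → ℤ) : ℝ :=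
  if (∀ r, |(y r : ℝ) - y 0| ≤ β * |(y 0 : ℝ)|) ∧ (1 - β) * T ≤ |(y 0 : ℝ)| then
    |(y 0 : ℝ)| ^ p else 0

variable {ε p T : ℝ}

/-- Some readout is at most `z`, another at least `z`, and both are within `ε / 8 * |y 0|` of `y 0`;
hence so is `z`. The rest is `(1 - ε / 8) ^ 2 ≥ 1 - ε` for the threshold and `(1 - ε / 8) ^ (-2) ≤ 1
+ ε / 2` for the weight, `p = 2` being the worst exponent. -/
lemma acceptedWeight_le (hε : ε ∈ Set.Ioo (0 : ℝ) 1) (hp : p ∈ Set.Icc (0 : ℝ) 2) (hT : 1 ≤ T)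
    {y : Fin R → ℤ} {z : ℤ} (h1 : ¬ ∀ r, z < y r) (h2 : ¬ ∀ r, y r < z) :
    acceptedWeight (ε / 8) p T y ≤
      if (1 - ε) * T ≤ |(z : ℝ)| then (1 + ε / 2) * absPow p z else 0 := by
  obtain ⟨hε0, hε1⟩ := hε
  have hR : 0 ≤ (if (1 - ε) * T ≤ |(z : ℝ)| then (1 + ε / 2) * absPow p z else 0) := by
    have := absPow_nonneg p z
    split_ifs <;> positivity
  by_cases hacc : (∀ r, |(y r : ℝ) - y 0| ≤ ε / 8 * |(y 0 : ℝ)|) ∧ (1 - ε / 8) * T ≤ |(y 0 : ℝ)|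
  swap
  · rwa [acceptedWeight, if_neg hacc]
  rw [acceptedWeight, if_pos hacc]
  obtain ⟨hw, hy⟩ := hacc
  push Not at h1 h2
  obtain ⟨r, hr⟩ := h1
  obtain ⟨s, hs⟩ := h2
  have hr' : (y r : ℝ) ≤ z := by exact_mod_cast hr
  have hs' : (z : ℝ) ≤ y s := by exact_mod_cast hs
  have hz : |(z : ℝ) - y 0| ≤ ε / 8 * |(y 0 : ℝ)| := by
    have hwr := abs_le.1 (hw r)
    have hws := abs_le.1 (hw s)
    exact abs_le.2 ⟨by linarith, by linarith⟩
  have hlow : (1 - ε / 8) * |(y 0 : ℝ)| ≤ |(z : ℝ)| := by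
    have := abs_sub_abs_le_abs_sub (y 0 : ℝ) z
    rw [abs_sub_comm] at this
    linarith
  have hge : (1 - ε) * T ≤ |(z : ℝ)| := by
    refine le_trans ?_ hlow
    have hsq : 1 - ε ≤ (1 - ε / 8) ^ 2 := by nlinarith
    calc (1 - ε) * T ≤ (1 - ε / 8) ^ 2 * T := by gcongr
      _ = (1 - ε / 8) * ((1 - ε / 8) * T) := by ring
      _ ≤ _ := by gcongr; linarith
  have hzpos : 0 < |(z : ℝ)| := lt_of_lt_of_le (by nlinarith) hge
  have hz0 : z ≠ 0 := by rintro rfl; simp at hzpos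
  rw [if_pos hge, absPow_of_ne hz0]
  set b := 1 - ε / 8 with hb
  have hb0 : 0 < b := by rw [hb]; linarith
  have hle : |(y 0 : ℝ)| ≤ b⁻¹ * |(z : ℝ)| := by
    rw [← div_eq_inv_mul, le_div_iff₀ hb0]; linarith
  calc |(y 0 : ℝ)| ^ p ≤ (b⁻¹ * |(z : ℝ)|) ^ p := by gcongr; exact hp.1
    _ = b⁻¹ ^ p * |(z : ℝ)| ^ p := Real.mul_rpow (by positivity) (by positivity)
    _ ≤ b⁻¹ ^ (2 : ℝ) * |(z : ℝ)| ^ p := by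
        gcongr
        · exact (one_le_inv₀ hb0).2 (by rw [hb]; linarith)
        · exact hp.2
    _ ≤ (1 + ε / 2) * |(z : ℝ)| ^ p := by
        gcongr
        rw [Real.rpow_two, inv_pow, inv_le_iff_one_le_mul₀ (by positivity), hb]
        nlinarith [mul_pos hε0 hε0, mul_pos (mul_pos hε0 hε0) hε0]

/-- Accuracy `ε / 32` makes any two readouts differ by at most `ε / 16 * |z|`, and `|z| ≤ 2 * |y 0|`
turns this into the tolerance `ε / 8 * |y 0|` of the acceptance test. -/
lemma le_acceptedWeight (hε : ε ∈ Set.Ioo (0 : ℝ) 1) (hp : p ∈ Set.Icc (0 : ℝ) 2) (hT : 1 ≤ T)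
    {y : Fin R → ℤ} {z : ℤ} (hz : T ≤ |(z : ℝ)|)
    (hy : ∀ r, |(y r : ℝ) - z| ≤ ε / 32 * |(z : ℝ)|) :
    (1 - ε / 2) * absPow p z ≤ acceptedWeight (ε / 8) p T y := by
  obtain ⟨hε0, hε1⟩ := hε
  have hz0 : z ≠ 0 := by
    rintro rfl
    simp at hz
    linarith
  have hlow : (1 - ε / 32) * |(z : ℝ)| ≤ |(y 0 : ℝ)| := by
    have := abs_sub_abs_le_abs_sub (z : ℝ) (y 0)
    rw [abs_sub_comm] at this
    linarith [hy 0]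
  have hzn := abs_nonneg (z : ℝ)
  rw [acceptedWeight, if_pos, absPow_of_ne hz0]
  · calc (1 - ε / 2) * |(z : ℝ)| ^ p ≤ (1 - ε / 32) ^ (2 : ℝ) * |(z : ℝ)| ^ p := by
          gcongr
          rw [Real.rpow_two]
          nlinarith
      _ ≤ (1 - ε / 32) ^ p * |(z : ℝ)| ^ p := by
          gcongr ?_ * _
          exact Real.rpow_le_rpow_of_exponent_ge (by linarith) (by linarith) hp.2
      _ = ((1 - ε / 32) * |(z : ℝ)|) ^ p := (Real.mul_rpow (by linarith) (by positivity)).symm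
      _ ≤ |(y 0 : ℝ)| ^ p := by
          gcongr
          · nlinarith
          · exact hp.1
  · refine ⟨fun r => ?_, ?_⟩
    · have h := abs_sub_le (y r : ℝ) z (y 0)
      rw [abs_sub_comm (z : ℝ) (y 0)] at h
      have h2 : ε / 16 * |(z : ℝ)| ≤ ε / 8 * |(y 0 : ℝ)| := by
        have : |(z : ℝ)| ≤ 2 * |(y 0 : ℝ)| := by nlinarith
        nlinarith
      linarith [hy r, hy 0]
    · refine le_trans ?_ hlow
      have h1 : (1 - ε / 8) * T ≤ (1 - ε / 8) * |(z : ℝ)| := by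
        gcongr; linarith
      nlinarith

end Accept

/-! ### Moments of large coordinates -/

section Moments

variable {n : ℕ} {ε p T : ℝ}

lemma absPow_of_one_le {z : ℤ} (hT : 1 ≤ T) (hz : T ≤ |(z : ℝ)|) (p : ℝ) :
    absPow p z = |(z : ℝ)| ^ p := by
  refine absPow_of_ne ?_
  rintro rfl
  simp at hz
  linarith

lemma one_le_absPow {z : ℤ} (hp : 0 ≤ p) (hT : 1 ≤ T) (hz : T ≤ |(z : ℝ)|) :
    1 ≤ absPow p z := by
  rw [absPow_of_one_le hT hz]
  exact Real.one_le_rpow (hT.trans hz) hp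

lemma absPow_le_largeMoment {x : Fin n → ℤ} {i : Fin n} (hi : T ≤ |(x i : ℝ)|) :
    absPow p (x i) ≤ largeMoment p T x := by
  classical
  rw [largeMoment]
  exact Finset.single_le_sum (f := fun i => absPow p (x i)) (fun j _ => absPow_nonneg _ _)
    (by simpa using hi)

lemma sum_ite_large (p T c : ℝ) (x : Fin n → ℤ) :
    ∑ i, (if T ≤ |(x i : ℝ)| then c * absPow p (x i) else 0) = c * largeMoment p T x := by
  classical
  rw [largeMoment, Finset.mul_sum, Finset.sum_filter]

lemma sum_ite_near_le (hε : 0 < ε) (hp : 0 ≤ p) (hT : 1 ≤ T) (x : Fin n → ℤ) :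
    ∑ i, (if (1 - ε) * T ≤ |(x i : ℝ)| then (1 + ε / 2) * absPow p (x i) else 0) ≤
      (1 + ε / 2) * (largeMoment p T x + T ^ p * nearCount ε T x) := by
  classical
  have h1 : T ^ p * (nearCount ε T x : ℝ) =
      ∑ i, if |(x i : ℝ)| ∈ Set.Ico ((1 - ε) * T) T then T ^ p else 0 := by
    rw [← Finset.sum_filter, Finset.sum_const, nsmul_eq_mul, mul_comm, nearCount,
      Set.ncard_eq_toFinset_card']
    congr 3
    ext i
    simp
  have h2 := sum_ite_large p T 1 x
  rw [one_mul] at h2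
  rw [h1, ← h2, ← Finset.sum_add_distrib, Finset.mul_sum]
  refine Finset.sum_le_sum fun i _ => ?_
  have hTp : 0 ≤ T ^ p := by positivity
  have hw := absPow_nonneg p (x i)
  by_cases hL : T ≤ |(x i : ℝ)|
  · have h3 : (1 - ε) * T ≤ |(x i : ℝ)| := le_trans (by nlinarith) hL
    have h4 : ¬ |(x i : ℝ)| ∈ Set.Ico ((1 - ε) * T) T := fun h => absurd h.2 (not_lt.2 hL)
    rw [if_pos h3, if_pos hL, if_neg h4, one_mul, add_zero]
  · by_cases h3 : (1 - ε) * T ≤ |(x i : ℝ)|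
    · rw [if_pos h3, if_neg hL, if_pos ⟨h3, not_le.1 hL⟩, zero_add]
      gcongr
      rw [absPow]
      split_ifs
      · exact hTp
      · exact Real.rpow_le_rpow (abs_nonneg _) (not_le.1 hL).le hp
    · rw [if_neg h3, if_neg hL, zero_add]
      split_ifs <;> positivity

/-- If `a ≤ b` in absolute value, the ratio of squares is at most the ratio of `p`-th powers. -/
lemma sq_div_sq_le_rpow_div {a b : ℝ} (ha : 0 ≤ a) (hb : 0 < b) (hab : a ≤ b)
    (hp : p ∈ Set.Icc (0 : ℝ) 2) : a ^ 2 / b ^ 2 ≤ a ^ p / b ^ p := by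
  rcases ha.eq_or_lt with rfl | ha
  · simp only [ne_eq, OfNat.ofNat_ne_zero, not_false_eq_true, zero_pow, zero_div]
    positivity
  rw [← div_pow, ← Real.div_rpow ha.le hb.le, ← Real.rpow_two]
  exact Real.rpow_le_rpow_of_exponent_ge (by positivity) ((div_le_one hb).2 hab) hp.2

/-- The truncated energy of a vector satisfying the tail condition, relative to one of its large
coordinates. -/
lemma sum_truncated_le (hp : p ∈ Set.Icc (0 : ℝ) 2) (hT : 1 ≤ T) {κ Λ m : ℝ} (hκ : 0 < κ)
    (hκ1 : κ ≤ 1) (hΛ : 0 ≤ Λ) (hm : 0 ≤ m) {x : Fin n → ℤ}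
    (hmin : ∀ i, T ≤ |(x i : ℝ)| → m ≤ |(x i : ℝ)|)
    (htail : ∑ i ∈ univ.filter (fun i => ¬ T ≤ |(x i : ℝ)|), (x i : ℝ) ^ 2 ≤
      Λ * ((univ.filter fun i => T ≤ |(x i : ℝ)|).card * m ^ 2))
    {i : Fin n} (hi : T ≤ |(x i : ℝ)|) :
    ∑ j, min 1 ((x j : ℝ) ^ 2 / (κ * |(x i : ℝ)|) ^ 2) ≤
      (1 + Λ) * largeMoment p T x / (κ ^ 2 * absPow p (x i)) := by
  set v := |(x i : ℝ)| with hv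
  have hv0 : 0 < v := by linarith
  have hw : absPow p (x i) = v ^ p := absPow_of_one_le hT hi p
  have hvp : 0 < v ^ p := by positivity
  have hκ2 : κ ^ 2 ≤ 1 := pow_le_one₀ hκ.le hκ1
  -- Entries above `v` are truncated to `1`, which is at most their `p`-th power over `v ^ p`; for
  -- entries below `v`, squares of ratios are at most `p`-th powers because `p ≤ 2`.
  have hL : ∑ j ∈ univ.filter (fun j => T ≤ |(x j : ℝ)|),
      min 1 ((x j : ℝ) ^ 2 / (κ * v) ^ 2) ≤ largeMoment p T x / (κ ^ 2 * v ^ p) := by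
    rw [largeMoment, Finset.sum_div]
    refine Finset.sum_le_sum fun j hj => ?_
    have hj' : T ≤ |(x j : ℝ)| := by simpa using hj
    rw [absPow_of_one_le hT hj']
    rcases le_total v |(x j : ℝ)| with h | h
    · refine (min_le_left _ _).trans ?_
      rw [one_le_div (by positivity)]
      calc κ ^ 2 * v ^ p ≤ 1 * v ^ p := by gcongr
        _ ≤ |(x j : ℝ)| ^ p := by rw [one_mul]; exact Real.rpow_le_rpow hv0.le h hp.1
    · refine (min_le_right _ _).trans ?_
      have := sq_div_sq_le_rpow_div (abs_nonneg _) hv0 h hp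
      rw [mul_pow, ← sq_abs (x j : ℝ), mul_comm (κ ^ 2), mul_comm (κ ^ 2), ← div_div, ← div_div]
      gcongr
  -- The tail is charged to as many copies of `m ^ 2` as there are large entries. Since `m ≤ v`,
  -- exponent `2` may be lowered to `p`, and each copy of `m ^ p` is dominated by one large entry.
  have hS : ∑ j ∈ univ.filter (fun j => ¬ T ≤ |(x j : ℝ)|),
      min 1 ((x j : ℝ) ^ 2 / (κ * v) ^ 2) ≤ Λ * largeMoment p T x / (κ ^ 2 * v ^ p) := by
    calc _ ≤ ∑ j ∈ univ.filter (fun j => ¬ T ≤ |(x j : ℝ)|), (x j : ℝ) ^ 2 / (κ * v) ^ 2 :=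
          Finset.sum_le_sum fun j _ => min_le_right _ _
      _ = (∑ j ∈ univ.filter (fun j => ¬ T ≤ |(x j : ℝ)|), (x j : ℝ) ^ 2) / (κ * v) ^ 2 :=
          (Finset.sum_div _ _ _).symm
      _ ≤ Λ * ((univ.filter fun i => T ≤ |(x i : ℝ)|).card * m ^ 2) / (κ * v) ^ 2 := by gcongr
      _ = Λ * ((univ.filter fun i => T ≤ |(x i : ℝ)|).card * (m ^ 2 / v ^ 2)) / κ ^ 2 := by
          rw [mul_pow]; field_simp
      _ ≤ Λ * ((univ.filter fun i => T ≤ |(x i : ℝ)|).card * (m ^ p / v ^ p)) / κ ^ 2 := by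
          gcongr Λ * (_ * ?_) / _
          exact sq_div_sq_le_rpow_div hm hv0 (hmin i hi) hp
      _ = Λ * ((univ.filter fun i => T ≤ |(x i : ℝ)|).card * m ^ p) / (κ ^ 2 * v ^ p) := by
          field_simp
      _ ≤ _ := by
          gcongr
          rw [largeMoment, ← nsmul_eq_mul]
          refine Finset.card_nsmul_le_sum _ _ _ fun j hj => ?_
          have hj' : T ≤ |(x j : ℝ)| := by simpa using hj
          rw [absPow_of_one_le hT hj']
          exact Real.rpow_le_rpow hm (hmin j hj') hp.1
  rw [← Finset.sum_filter_add_sum_filter_not univ (fun j => T ≤ |(x j : ℝ)|), hw]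
  refine (add_le_add hL hS).trans (le_of_eq ?_)
  ring

/-- Choosing the scale: the estimate at the greatest scale which is not larger than the estimate
itself is accurate. -/
lemma abs_estimate_sub_le {F N : ℝ} (hε : ε ∈ Set.Ioo (0 : ℝ) 1) (hF : 0 < F) (hN : 0 ≤ N)
    {est : ℕ → ℝ} {g₀ G : ℕ} (hg₀ : (2 : ℝ) ^ g₀ ≤ F) (hG : g₀ ≤ G)
    (hup : ∀ g ≤ G, est g ≤ (1 + ε / 2) * (F + N) + ε / 8 * max (F + N) (2 ^ g / 4))
    (hlow : ∀ g ≤ G, g₀ ≤ g → (1 - ε / 2) * F - ε / 4 * max F (2 ^ g / 4) ≤ est g)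
    [DecidablePred fun g => (2 : ℝ) ^ g / 4 ≤ est g] :
    |est (Nat.findGreatest (fun g => (2 : ℝ) ^ g / 4 ≤ est g) G) - F| ≤
      ε * F + (1 + ε) * N := by
  obtain ⟨hε0, hε1⟩ := hε
  -- The scale `g₀` passes the test: its estimate is at least `(1 - 3 * ε / 4) * F ≥ F / 4`.
  have h0 : (2 : ℝ) ^ g₀ / 4 ≤ est g₀ := by
    have := hlow g₀ hG le_rfl
    rw [max_eq_left (by linarith)] at this
    nlinarith
  set g := Nat.findGreatest (fun g => (2 : ℝ) ^ g / 4 ≤ est g) G with hg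
  have hgG : g ≤ G := Nat.findGreatest_le G
  have hspec : (2 : ℝ) ^ g / 4 ≤ est g :=
    Nat.findGreatest_spec (P := fun g => (2 : ℝ) ^ g / 4 ≤ est g) hG h0
  have hgg : g₀ ≤ g := Nat.le_findGreatest hG h0
  have hu := hup g hgG
  have hl := hlow g hgG hgg
  set V := (2 : ℝ) ^ g / 4
  -- A selected scale cannot be too coarse: for `V > 2 * (F + N)` the upper bound would force the
  -- estimate below `7 / 8 * V`, contradicting its selection.
  have hV : V ≤ 2 * (F + N) := by
    by_contra hcon
    push Not at hcon
    rw [max_eq_right (by linarith)] at hu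
    nlinarith
  have hmax : max (F + N) V ≤ 2 * (F + N) := max_le (by linarith) hV
  have hmax' : max F V ≤ 2 * (F + N) := max_le (by linarith) hV
  rw [abs_le]
  constructor
  · nlinarith
  · nlinarith

end Moments

/-! ### The moment sketch -/

section MomentSketch

variable {n R B : ℕ} {ε p T : ℝ}

/-- The threshold sampling estimate at scale `τ`. -/
noncomputable def momentEstimate [NeZero R] (ε p T τ : ℝ) (ω : SketchSeed n R B)
    (y : SketchRow n R B → ℤ) : ℝ :=
  ∑ i, thresholdSample n τ (acceptedWeight (ε / 8) p T (readout ω y i)) ((ω.1 i : ℕ) + 1)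

open Classical in
/-- The post-processing: the estimate at a scale proportional to the estimated moment. -/
noncomputable def momentDecode [NeZero R] (ε p T A : ℝ) (G : ℕ) (ω : SketchSeed n R B)
    (y : SketchRow n R B → ℤ) : ℝ :=
  momentEstimate ε p T (2 ^ Nat.findGreatest
    (fun g => (2 : ℝ) ^ g / 4 ≤ momentEstimate ε p T (2 ^ g / (4 * A)) ω y) G / (4 * A)) ω y

/-- For the zero vector the moment vanishes and relative error allows no slack, so the output has to
be exact. -/
lemma momentEstimate_zero [NeZero R] (hε : ε ∈ Set.Ioo (0 : ℝ) 1) (hT : 1 ≤ T) {τ : ℝ} (hτ : 0 < τ)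
    (ω : SketchSeed n R B) : momentEstimate ε p T τ ω 0 = 0 := by
  refine Finset.sum_eq_zero fun i _ => ?_
  have h0 : ∀ r, readout ω 0 i r = 0 := fun r => by simp [readout]
  have : acceptedWeight (ε / 8) p T (readout ω 0 i) = 0 := by
    rw [acceptedWeight, if_neg]
    simp only [h0, Int.cast_zero, abs_zero, not_and, not_le]
    intro _
    have := hε.2
    nlinarith
  rw [this]
  exact thresholdSample_zero hτ (by positivity)

/-- For weight `w`, the collision probability carries `(w / τ) ^ 2` and the truncated energy `F /
w`. The product is linear in `w`, so the sum over all large coordinates costs only another factor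
`F`. -/
lemma unifProb_exists_inaccurate_le [NeZero n] [NeZero B] (hp : p ∈ Set.Icc (0 : ℝ) 2)
    (hT : 1 ≤ T) {κ Λ m τ : ℝ} (hκ : 0 < κ) (hκ1 : κ ≤ 1) (hΛ : 0 ≤ Λ) (hm : 0 ≤ m)
    (hτ : 0 < τ) {x : Fin n → ℤ}
    (hmin : ∀ i, T ≤ |(x i : ℝ)| → m ≤ |(x i : ℝ)|)
    (htail : ∑ i ∈ univ.filter (fun i => ¬ T ≤ |(x i : ℝ)|), (x i : ℝ) ^ 2 ≤
      Λ * ((univ.filter fun i => T ≤ |(x i : ℝ)|).card * m ^ 2)) :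
    unifProb (fun ω : SketchSeed n R B => ∃ i ∈ univ.filter (fun i => T ≤ |(x i : ℝ)|),
      ∃ r ∈ (univ : Finset (Fin R)), ((ω.1 i : ℕ) : ℝ) + 1 ≤ n * (absPow p (x i) / τ) ∧
        κ * |(x i : ℝ)| < |(readout ω ((sketchMatrix ω).mulVec x) i r : ℝ) - x i|) ≤
      2 * R * (1 + Λ) * (largeMoment p T x / τ) ^ 2 / (κ ^ 2 * B) := by
  have hB : (0 : ℝ) < B := by exact_mod_cast Nat.pos_of_ne_zero (NeZero.ne B)
  refine (unifProb_exists_le _ _).trans ?_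
  have hterm : ∀ i ∈ univ.filter (fun i => T ≤ |(x i : ℝ)|),
      unifProb (fun ω : SketchSeed n R B => ∃ r ∈ (univ : Finset (Fin R)),
        ((ω.1 i : ℕ) : ℝ) + 1 ≤ n * (absPow p (x i) / τ) ∧
        κ * |(x i : ℝ)| < |(readout ω ((sketchMatrix ω).mulVec x) i r : ℝ) - x i|) ≤
      (2 * R * (1 + Λ) * largeMoment p T x / (τ ^ 2 * κ ^ 2 * B)) * absPow p (x i) := by
    intro i hi
    have hi' : T ≤ |(x i : ℝ)| := by simpa using hi
    have hw := one_le_absPow hp.1 hT hi'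
    refine (unifProb_exists_le _ _).trans ?_
    have hr : ∀ r ∈ (univ : Finset (Fin R)), unifProb (fun ω : SketchSeed n R B =>
        ((ω.1 i : ℕ) : ℝ) + 1 ≤ n * (absPow p (x i) / τ) ∧
        κ * |(x i : ℝ)| < |(readout ω ((sketchMatrix ω).mulVec x) i r : ℝ) - x i|) ≤
        2 * (absPow p (x i) / τ) ^ 2 / B *
          ((1 + Λ) * largeMoment p T x / (κ ^ 2 * absPow p (x i))) := by
      intro r _
      refine (unifProb_inaccurate_le x i r (mul_pos hκ (by linarith)) (by positivity)).trans ?_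
      gcongr
      exact sum_truncated_le hp hT hκ hκ1 hΛ hm hmin htail hi'
    refine (Finset.sum_le_card_nsmul _ _ _ hr).trans (le_of_eq ?_)
    rw [Finset.card_univ, Fintype.card_fin, nsmul_eq_mul]
    field_simp
  refine (Finset.sum_le_sum hterm).trans (le_of_eq ?_)
  rw [← Finset.mul_sum]
  rw [show ∑ i ∈ univ.filter (fun i => T ≤ |(x i : ℝ)|), absPow p (x i) =
    largeMoment p T x from rfl]
  field_simp

end MomentSketch

/-! ### Accuracy of the moment sketch -/

section MomentSketchAccuracy

variable {n R B : ℕ} [NeZero R] {ε p T : ℝ}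

lemma momentEstimate_le (hε : ε ∈ Set.Ioo (0 : ℝ) 1) (hp : p ∈ Set.Icc (0 : ℝ) 2) (hT : 1 ≤ T)
    {τ : ℝ} (hτ : 0 < τ) {ω : SketchSeed n R B} {x : Fin n → ℤ}
    (hsound : ∀ i, (¬ ∀ r, x i < readout ω ((sketchMatrix ω).mulVec x) i r) ∧
      ¬ ∀ r, readout ω ((sketchMatrix ω).mulVec x) i r < x i) :
    momentEstimate ε p T τ ω ((sketchMatrix ω).mulVec x) ≤
      ∑ i, thresholdSample n τ
        (if (1 - ε) * T ≤ |(x i : ℝ)| then (1 + ε / 2) * absPow p (x i) else 0)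
        ((ω.1 i : ℕ) + 1) :=
  Finset.sum_le_sum fun i _ =>
    thresholdSample_mono hτ (acceptedWeight_le hε hp hT (hsound i).1 (hsound i).2) _

/-- A coordinate whose sampling value exceeds `n * w / τ₀` contributes nothing to the left-hand side
at any scale `τ ≥ τ₀`. Accurate readouts at the single scale `τ₀` therefore serve all coarser
scales. -/
lemma le_momentEstimate (hε : ε ∈ Set.Ioo (0 : ℝ) 1) (hp : p ∈ Set.Icc (0 : ℝ) 2) (hT : 1 ≤ T)
    {τ₀ τ : ℝ} (hτ₀ : 0 < τ₀) (hτ : τ₀ ≤ τ) {ω : SketchSeed n R B} {x : Fin n → ℤ}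
    (hcomplete : ∀ i, T ≤ |(x i : ℝ)| →
      ((ω.1 i : ℕ) : ℝ) + 1 ≤ n * (absPow p (x i) / τ₀) → ∀ r,
        |(readout ω ((sketchMatrix ω).mulVec x) i r : ℝ) - x i| ≤ ε / 32 * |(x i : ℝ)|) :
    ∑ i, thresholdSample n τ (if T ≤ |(x i : ℝ)| then (1 - ε / 2) * absPow p (x i) else 0)
        ((ω.1 i : ℕ) + 1) ≤
      momentEstimate ε p T τ ω ((sketchMatrix ω).mulVec x) := by
  have hτ' : 0 < τ := hτ₀.trans_le hτ
  refine Finset.sum_le_sum fun i _ => ?_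
  by_cases hi : T ≤ |(x i : ℝ)|
  · rw [if_pos hi]
    by_cases ht : ((ω.1 i : ℕ) : ℝ) + 1 ≤ n * (absPow p (x i) / τ₀)
    · exact thresholdSample_mono hτ' (le_acceptedWeight hε hp hT hi (hcomplete i hi ht)) _
    · rw [thresholdSample, if_neg]
      · exact thresholdSample_nonneg hτ' _ _
      · intro h
        refine ht ?_
        rw [← mul_div_assoc, le_div_iff₀ hτ₀]
        have hw := absPow_nonneg p (x i)
        have hε0 := hε.1
        calc (((ω.1 i : ℕ) : ℝ) + 1) * τ₀ ≤ (((ω.1 i : ℕ) : ℝ) + 1) * τ := by gcongr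
          _ = τ * (((ω.1 i : ℕ) : ℝ) + 1) := mul_comm _ _
          _ ≤ n * ((1 - ε / 2) * absPow p (x i)) := h
          _ ≤ n * absPow p (x i) := by gcongr; nlinarith
  · rw [if_neg hi, thresholdSample_zero hτ' (by positivity)]
    exact thresholdSample_nonneg hτ' _ _

/-- This bounds Chebyshev's quotient at scale `V / A` for deviation `b * max U V`. Since `max U V ^
2 ≥ U * V`, the result does not depend on how `U` and `V` compare. -/
lemma max_sq_bound {U V b : ℝ} (hU : 0 < U) (hV : 0 < V) (hb : 0 < b) {A W c : ℝ} (hA : 0 < A)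
    (hc : 0 ≤ c) (hW : W ≤ c * U) :
    V / A * W / (b * max U V) ^ 2 ≤ c / (b ^ 2 * A) := by
  have h1 : U * V ≤ max U V ^ 2 := by
    rw [sq]
    exact mul_le_mul (le_max_left _ _) (le_max_right _ _) hV.le (hU.le.trans (le_max_left _ _))
  calc V / A * W / (b * max U V) ^ 2 ≤ V / A * (c * U) / (b ^ 2 * (U * V)) := by
        rw [mul_pow]
        gcongr
    _ = _ := by field_simp

/-- The failure probability of the moment sketch. -/
theorem unifProb_momentDecode_fail_le [NeZero n] [NeZero B] (hε : ε ∈ Set.Ioo (0 : ℝ) 1)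
    (hp : p ∈ Set.Icc (0 : ℝ) 2) (hT : 1 ≤ T) {A Λ m : ℝ} {G : ℕ} (hA : 8 / ε ≤ A)
    (hΛ : 0 ≤ Λ) (hm : 0 ≤ m) {x : Fin n → ℤ} (hne : ∃ i, T ≤ |(x i : ℝ)|)
    (hmin : ∀ i, T ≤ |(x i : ℝ)| → m ≤ |(x i : ℝ)|)
    (htail : ∑ i ∈ univ.filter (fun i => ¬ T ≤ |(x i : ℝ)|), (x i : ℝ) ^ 2 ≤
      Λ * ((univ.filter fun i => T ≤ |(x i : ℝ)|).card * m ^ 2))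
    (hG : largeMoment p T x < 2 ^ (G + 1)) :
    unifProb (fun ω : SketchSeed n R B =>
      ¬ |momentDecode ε p T A G ω ((sketchMatrix ω).mulVec x) - largeMoment p T x| ≤
        ε * largeMoment p T x + (1 + ε) * T ^ p * (nearCount ε T x : ℝ)) ≤
      n * (2 * (1 / 2) ^ R) + 131072 * R * (1 + Λ) * A ^ 2 / (ε ^ 2 * B) +
        (G + 1) * (192 / (ε ^ 2 * A)) := by
  classical
  have hε0 := hε.1
  have hε1 := hε.2
  have hA0 : 0 < A := lt_of_lt_of_le (by positivity) hA
  have hεA : 8 ≤ ε * A := by rwa [div_le_iff₀' hε0] at hA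
  have hB : (0 : ℝ) < B := by exact_mod_cast Nat.pos_of_ne_zero (NeZero.ne B)
  set F := largeMoment p T x with hF
  have hF1 : 1 ≤ F := by
    obtain ⟨i, hi⟩ := hne
    exact (one_le_absPow hp.1 hT hi).trans (absPow_le_largeMoment hi)
  set N := T ^ p * (nearCount ε T x : ℝ) with hN
  have hN0 : 0 ≤ N := by positivity
  obtain ⟨g₀, hg₀, hg₀'⟩ : ∃ g : ℕ, (2 : ℝ) ^ g ≤ F ∧ F < 2 ^ (g + 1) :=
    exists_nat_pow_near hF1 one_lt_two
  have hg₀G : g₀ ≤ G := by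
    have : (2 : ℝ) ^ g₀ < 2 ^ (G + 1) := hg₀.trans_lt hG
    have := (pow_lt_pow_iff_right₀ (one_lt_two : (1 : ℝ) < 2)).1 this
    omega
  -- The sandwiching weights `wu` and `wl` are functions of `x` only, hence independent of the
  -- sampling values.
  set wu : Fin n → ℝ := fun i =>
    if (1 - ε) * T ≤ |(x i : ℝ)| then (1 + ε / 2) * absPow p (x i) else 0 with hwu
  set wl : Fin n → ℝ := fun i =>
    if T ≤ |(x i : ℝ)| then (1 - ε / 2) * absPow p (x i) else 0 with hwl
  have hwu0 : ∀ i, 0 ≤ wu i := fun i => by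
    have := absPow_nonneg p (x i)
    simp only [hwu]
    split_ifs <;> positivity
  have hwl0 : ∀ i, 0 ≤ wl i := fun i => by
    have := absPow_nonneg p (x i)
    simp only [hwl]
    split_ifs
    · exact mul_nonneg (by linarith) this
    · exact le_rfl
  have hwu_sum : ∑ i, wu i ≤ (1 + ε / 2) * (F + N) := sum_ite_near_le hε0 hp.1 hT x
  have hwl_sum : ∑ i, wl i = (1 - ε / 2) * F := sum_ite_large p T _ x
  let τ : ℕ → ℝ := fun g => 2 ^ g / (4 * A)
  have hτ : ∀ g, 0 < τ g := fun g => by positivity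
  have hτV : ∀ g, τ g = 2 ^ g / 4 / A := fun g => by simp only [τ]; rw [div_div]
  set E₁ : SketchSeed n R B → Prop := fun ω => ∃ i ∈ (univ : Finset (Fin n)),
    (∀ r, x i < readout ω ((sketchMatrix ω).mulVec x) i r) ∨
      (∀ r, readout ω ((sketchMatrix ω).mulVec x) i r < x i) with hE₁
  set E₂ : SketchSeed n R B → Prop := fun ω => ∃ i ∈ univ.filter (fun i => T ≤ |(x i : ℝ)|),
    ∃ r ∈ (univ : Finset (Fin R)), ((ω.1 i : ℕ) : ℝ) + 1 ≤ n * (absPow p (x i) / τ g₀) ∧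
      ε / 32 * |(x i : ℝ)| < |(readout ω ((sketchMatrix ω).mulVec x) i r : ℝ) - x i| with hE₂
  set D : ℕ → (Fin n → Fin n) → Prop := fun g t =>
    (∑ i, wu i + ε / 8 * max (F + N) (2 ^ g / 4) <
      ∑ i, thresholdSample n (τ g) (wu i) ((t i : ℕ) + 1)) ∨
    (∑ i, thresholdSample n (τ g) (wl i) ((t i : ℕ) + 1) <
      ∑ i, wl i - τ g - ε / 8 * max F (2 ^ g / 4)) with hD
  set E₃ : SketchSeed n R B → Prop := fun ω => ∃ g ∈ range (G + 1), D g ω.1 with hE₃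
  have hsub : ∀ ω : SketchSeed n R B,
      (¬ |momentDecode ε p T A G ω ((sketchMatrix ω).mulVec x) - F| ≤
        ε * F + (1 + ε) * T ^ p * (nearCount ε T x : ℝ)) → (E₁ ω ∨ E₂ ω) ∨ E₃ ω := by
    intro ω
    contrapose!
    rintro ⟨⟨h1, h2⟩, h3⟩
    have hsound : ∀ i, (¬ ∀ r, x i < readout ω ((sketchMatrix ω).mulVec x) i r) ∧
        ¬ ∀ r, readout ω ((sketchMatrix ω).mulVec x) i r < x i := fun i =>
      ⟨fun h => h1 ⟨i, mem_univ _, Or.inl h⟩, fun h => h1 ⟨i, mem_univ _, Or.inr h⟩⟩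
    have hcomplete : ∀ i, T ≤ |(x i : ℝ)| →
        ((ω.1 i : ℕ) : ℝ) + 1 ≤ n * (absPow p (x i) / τ g₀) → ∀ r,
        |(readout ω ((sketchMatrix ω).mulVec x) i r : ℝ) - x i| ≤ ε / 32 * |(x i : ℝ)| := by
      intro i hi ht r
      by_contra hcon
      exact h2 ⟨i, by simpa using hi, r, mem_univ _, ht, not_le.1 hcon⟩
    have hdev : ∀ g ≤ G, ¬ D g ω.1 := fun g hg h =>
      h3 ⟨g, Finset.mem_range.2 (by omega), h⟩
    rw [mul_assoc]
    refine abs_estimate_sub_le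
      (est := fun g => momentEstimate ε p T (2 ^ g / (4 * A)) ω ((sketchMatrix ω).mulVec x))
      hε (by linarith) hN0 hg₀ hg₀G ?_ ?_
    · intro g hg
      have h4 := hdev g hg
      simp only [hD, not_or, not_lt] at h4
      have h5 := momentEstimate_le hε hp hT (hτ g) hsound
      exact h5.trans (h4.1.trans (by linarith))
    · intro g hg hgg
      have h4 := hdev g hg
      simp only [hD, not_or, not_lt] at h4
      have hmono : τ g₀ ≤ τ g := by
        simp only [τ]
        gcongr
        exact one_le_two
      have h5 := le_momentEstimate hε hp hT (hτ g₀) hmono hcomplete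
      refine le_trans ?_ (h4.2.trans h5)
      have h6 : τ g ≤ ε / 8 * max F (2 ^ g / 4) := by
        refine le_trans ?_ (mul_le_mul_of_nonneg_left (le_max_right _ _) (by positivity))
        rw [hτV, div_le_iff₀ hA0]
        have : (0 : ℝ) < 2 ^ g / 4 := by positivity
        nlinarith
      linarith
  have hP₁ : unifProb E₁ ≤ n * (2 * (1 / 2) ^ R) := unifProb_exists_one_sided_le x
  have hP₂ : unifProb E₂ ≤ 131072 * R * (1 + Λ) * A ^ 2 / (ε ^ 2 * B) := by
    refine (unifProb_exists_inaccurate_le hp hT (by positivity) (by linarith) hΛ hm (hτ g₀)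
      hmin htail).trans ?_
    -- By the choice of `g₀`, `F < 2 ^ (g₀ + 1)`, which is `8 * A * τ g₀`. The constant below is
    -- `131072 = 2 * 8 ^ 2 * 32 ^ 2`.
    have hr : F / τ g₀ ≤ 8 * A := by
      rw [div_le_iff₀ (hτ g₀)]
      have : 8 * A * τ g₀ = 2 ^ (g₀ + 1) := by
        simp only [τ]
        rw [pow_succ]
        field_simp
        ring
      rw [this]
      exact hg₀'.le
    have hr0 : 0 ≤ F / τ g₀ := div_nonneg (by linarith) (hτ g₀).le
    calc 2 * R * (1 + Λ) * (F / τ g₀) ^ 2 / ((ε / 32) ^ 2 * B)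
        ≤ 2 * R * (1 + Λ) * (8 * A) ^ 2 / ((ε / 32) ^ 2 * B) := by gcongr
      _ = _ := by field_simp; ring
  have hP₃ : unifProb E₃ ≤ (G + 1) * (192 / (ε ^ 2 * A)) := by
    refine (unifProb_exists_le _ _).trans ?_
    have hterm : ∀ g ∈ range (G + 1),
        unifProb (fun ω : SketchSeed n R B => D g ω.1) ≤ 192 / (ε ^ 2 * A) := by
      intro g _
      rw [unifProb_prod]
      have hV : (0 : ℝ) < 2 ^ g / 4 := by positivity
      have hFN : 0 < F + N := by linarith
      have hle : 𝔼 t : Fin n → Fin n, unifProb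
          (fun _ : (Fin R → Fin n → Fin B) × (Fin R → Fin n → Bool) => D g t) =
          unifProb (D g) := by
        refine Finset.expect_congr rfl fun t _ => ?_
        rw [unifProb, Fintype.expect_const]
      rw [hle]
      refine (unifProb_or_le _ _).trans ?_
      have hb1 := unifProb_thresholdSample_gt_le (hτ g) hwu0
        (c := ε / 8 * max (F + N) (2 ^ g / 4))
        (mul_pos (by positivity) (lt_of_lt_of_le hV (le_max_right _ _)))
      have hb2 := unifProb_thresholdSample_lt_le (hτ g) hwl0
        (c := ε / 8 * max F (2 ^ g / 4))
        (mul_pos (by positivity) (lt_of_lt_of_le hV (le_max_right _ _)))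
      have hc1 := max_sq_bound hFN hV (b := ε / 8) (by positivity) hA0 (c := 2) zero_le_two
        (hwu_sum.trans (mul_le_mul_of_nonneg_right (by linarith) hFN.le))
      have hc2 := max_sq_bound (by linarith : 0 < F) hV (b := ε / 8) (by positivity) hA0
        (c := 1) zero_le_one
        (hwl_sum.le.trans (mul_le_mul_of_nonneg_right (by linarith) (by linarith)))
      rw [hτV] at hb1 hb2
      have hsum : 2 / ((ε / 8) ^ 2 * A) + 1 / ((ε / 8) ^ 2 * A) = 192 / (ε ^ 2 * A) := by
        field_simp
        norm_num
      rw [← hsum]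
      simp only [hτV]
      exact add_le_add (hb1.trans hc1) (hb2.trans hc2)
    refine (Finset.sum_le_card_nsmul _ _ _ hterm).trans (le_of_eq ?_)
    rw [Finset.card_range, nsmul_eq_mul]
    push_cast
    rfl
  refine (unifProb_mono hsub).trans ((unifProb_or_le _ _).trans ?_)
  exact add_le_add ((unifProb_or_le _ _).trans (add_le_add hP₁ hP₂)) hP₃

end MomentSketchAccuracy

/-! ### The tail condition in terms of sorted entries -/

section Sorted

variable {n : ℕ} {T : ℝ} {x : Fin n → ℤ} {k : ℕ}

lemma sortedEntry_succ (x : Fin n → ℤ) (j : Fin n) :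
    sortedEntry x ((j : ℕ) + 1) = x (Tuple.sort (fun i => -|x i|) j) := by
  simp [sortedEntry]

lemma abs_sortedEntry_antitone (x : Fin n → ℤ) {i j : Fin n} (hij : i ≤ j) :
    |(sortedEntry x ((j : ℕ) + 1) : ℝ)| ≤ |(sortedEntry x ((i : ℕ) + 1) : ℝ)| := by
  have h := Tuple.monotone_sort (fun i => -|x i|) hij
  simp only [Function.comp_apply, neg_le_neg_iff] at h
  rw [sortedEntry_succ, sortedEntry_succ]
  exact_mod_cast h

lemma le_abs_sortedEntry_iff
    (hk : IsGreatest {j : ℕ | 1 ≤ j ∧ j ≤ n ∧ T ≤ |(sortedEntry x j : ℝ)|} k) (j : Fin n) :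
    T ≤ |(sortedEntry x ((j : ℕ) + 1) : ℝ)| ↔ (j : ℕ) + 1 ≤ k := by
  constructor
  · intro h
    exact hk.2 ⟨by omega, j.2, h⟩
  · intro h
    obtain ⟨⟨h1, h2, h3⟩, -⟩ := hk
    have := abs_sortedEntry_antitone x (i := j) (j := ⟨k - 1, by omega⟩)
      (Fin.le_def.2 (by simp only; omega))
    simp only [Nat.sub_add_cancel h1] at this
    exact h3.trans this

lemma exists_large (hk : IsGreatest {j : ℕ | 1 ≤ j ∧ j ≤ n ∧ T ≤ |(sortedEntry x j : ℝ)|} k) :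
    ∃ i, T ≤ |(x i : ℝ)| := by
  obtain ⟨⟨h1, h2, h3⟩, -⟩ := hk
  rw [sortedEntry, dif_pos (by omega)] at h3
  exact ⟨_, h3⟩

lemma abs_sortedEntry_le
    (hk : IsGreatest {j : ℕ | 1 ≤ j ∧ j ≤ n ∧ T ≤ |(sortedEntry x j : ℝ)|} k) {i : Fin n}
    (hi : T ≤ |(x i : ℝ)|) : |(sortedEntry x k : ℝ)| ≤ |(x i : ℝ)| := by
  obtain ⟨j, rfl⟩ := (Tuple.sort fun i => -|x i|).surjective i
  rw [← sortedEntry_succ x j] at hi ⊢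
  have hj := (le_abs_sortedEntry_iff hk j).1 hi
  obtain ⟨⟨h1, h2, h3⟩, -⟩ := hk
  have := abs_sortedEntry_antitone x (i := j) (j := ⟨k - 1, by omega⟩)
    (Fin.le_def.2 (by simp only; omega))
  simpa only [Nat.sub_add_cancel h1] using this

lemma card_large (hk : IsGreatest {j : ℕ | 1 ≤ j ∧ j ≤ n ∧ T ≤ |(sortedEntry x j : ℝ)|} k) :
    (univ.filter fun i => T ≤ |(x i : ℝ)|).card = k := by
  have h : (univ.filter fun j : Fin n => (j : ℕ) < k).card =
      (univ.filter fun i => T ≤ |(x i : ℝ)|).card := by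
    refine Finset.card_equiv (Tuple.sort fun i => -|x i|) fun j => ?_
    simp only [mem_filter, mem_univ, true_and]
    rw [← sortedEntry_succ x j, le_abs_sortedEntry_iff hk]
    omega
  rw [← h, Fin.card_filter_val_lt, min_eq_right hk.1.2.1]

lemma sum_small_eq_tailSq
    (hk : IsGreatest {j : ℕ | 1 ≤ j ∧ j ≤ n ∧ T ≤ |(sortedEntry x j : ℝ)|} k) :
    ∑ i ∈ univ.filter (fun i => ¬ T ≤ |(x i : ℝ)|), (x i : ℝ) ^ 2 = tailSq x k := by
  rw [Finset.sum_filter, ← Equiv.sum_comp (Tuple.sort fun i => -|x i|)]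
  have h1 : ∀ j : Fin n, (if ¬ T ≤ |(x (Tuple.sort (fun i => -|x i|) j) : ℝ)| then
      (x (Tuple.sort (fun i => -|x i|) j) : ℝ) ^ 2 else 0) =
      (fun j : ℕ => if k < j + 1 then (sortedEntry x (j + 1) : ℝ) ^ 2 else 0) j := by
    intro j
    rw [← sortedEntry_succ x j]
    simp only [le_abs_sortedEntry_iff hk, not_le]
  rw [Finset.sum_congr rfl fun j _ => h1 j, Fin.sum_univ_eq_sum_range
    (fun j : ℕ => if k < j + 1 then (sortedEntry x (j + 1) : ℝ) ^ 2 else 0) n,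
    ← Finset.sum_filter, tailSq]
  refine Finset.sum_nbij (fun j => j + 1) ?_ ?_ ?_ fun _ _ => rfl
  · intro j hj
    simp only [mem_filter, mem_range, mem_Icc] at hj ⊢
    omega
  · intro a _ b _ h
    simpa using h
  · intro j hj
    simp only [coe_Icc, Set.mem_Icc] at hj
    exact ⟨j - 1, by simp only [coe_filter, mem_range, Set.mem_ofPred_eq]; omega,
      by simp only; omega⟩

end Sorted

/-! ### Thresholds below one -/

section SmallThreshold

variable {n : ℕ} {T : ℝ}

lemma one_le_abs_intCast {z : ℤ} (hz : z ≠ 0) : (1 : ℝ) ≤ |(z : ℝ)| := by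
  exact_mod_cast Int.one_le_abs hz

/-- Nonzero integers have absolute value at least `1`, and zero entries contribute nothing by the
convention on `absPow`. -/
lemma largeMoment_of_le_one (p : ℝ) (hT : T ≤ 1) (x : Fin n → ℤ) :
    largeMoment p T x = largeMoment p 1 x := by
  classical
  rw [largeMoment, largeMoment, Finset.sum_filter, Finset.sum_filter]
  refine Finset.sum_congr rfl fun i _ => ?_
  by_cases h : x i = 0
  · simp [h, absPow]
  · have h1 := one_le_abs_intCast h
    rw [if_pos h1, if_pos (hT.trans h1)]

lemma nearCount_one {ε : ℝ} (hε : ε < 1) (x : Fin n → ℤ) : nearCount ε 1 x = 0 := by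
  rw [nearCount, Set.ncard_eq_zero]
  refine Set.eq_empty_of_forall_notMem fun i hi => ?_
  obtain ⟨h1, h2⟩ := hi
  by_cases h : x i = 0
  · rw [h] at h1
    simp at h1
    linarith
  · exact absurd h2 (not_lt.2 (one_le_abs_intCast h))

lemma sum_small_one (x : Fin n → ℤ) :
    ∑ i ∈ univ.filter (fun i => ¬ (1 : ℝ) ≤ |(x i : ℝ)|), (x i : ℝ) ^ 2 = 0 := by
  refine Finset.sum_eq_zero fun i hi => ?_
  have h : x i = 0 := by
    by_contra hne
    exact (Finset.mem_filter.1 hi).2 (one_le_abs_intCast hne)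
  simp [h]

lemma largeMoment_le {p : ℝ} (hp : p ∈ Set.Icc (0 : ℝ) 2) (hT : 1 ≤ T) {x : Fin n → ℤ} {m : ℕ}
    (hx : ∀ i, |x i| ≤ (m : ℤ)) : largeMoment p T x ≤ n * m ^ 2 := by
  classical
  rw [largeMoment]
  have h : ∀ i ∈ univ.filter (fun i => T ≤ |(x i : ℝ)|), absPow p (x i) ≤ (m : ℝ) ^ 2 := by
    intro i hi
    have hi' : T ≤ |(x i : ℝ)| := by simpa using hi
    have hm : |(x i : ℝ)| ≤ m := by exact_mod_cast hx i
    rw [absPow_of_one_le hT hi']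
    calc |(x i : ℝ)| ^ p ≤ |(x i : ℝ)| ^ (2 : ℝ) :=
          Real.rpow_le_rpow_of_exponent_le (hT.trans hi') hp.2
      _ = |(x i : ℝ)| ^ 2 := Real.rpow_two _
      _ ≤ m ^ 2 := by gcongr
  refine (Finset.sum_le_card_nsmul _ _ _ h).trans ?_
  rw [nsmul_eq_mul]
  gcongr
  exact (Finset.card_filter_le _ _).trans (by simp)

end SmallThreshold

/-! ### Space -/

section Space

lemma clog_le_two_mul_logb {n : ℕ} (hn : 2 ≤ n) : (Nat.clog 2 n : ℝ) ≤ 2 * Real.logb 2 n := by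
  have h1 : (1 : ℝ) ≤ Real.logb 2 n := by
    rw [Real.le_logb_iff_rpow_le one_lt_two (by positivity), Real.rpow_one]
    exact_mod_cast hn
  rw [show Nat.clog 2 n = ⌈Real.logb 2 n⌉₊ by
    exact_mod_cast (Real.natCeil_logb_natCast 2 n).symm]
  have := Nat.ceil_lt_add_one (show 0 ≤ Real.logb 2 n by linarith)
  linarith

lemma card_inputs_lt {n : ℕ} (d : ℕ) :
    (2 * n ^ d + 1) ^ n < 2 ^ 2 ^ (2 * Nat.clog 2 n + d + 2) := by
  set L := Nat.clog 2 n
  have hL : n ≤ 2 ^ L := Nat.le_pow_clog one_lt_two n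
  have h1 : 2 * n ^ d + 1 ≤ 2 ^ (d * L + 2) := by
    have h : n ^ d ≤ 2 ^ (d * L) := by
      rw [mul_comm, pow_mul]
      exact Nat.pow_le_pow_left hL d
    have := Nat.one_le_two_pow (n := d * L)
    rw [pow_add]
    omega
  have h2 : d * L + 2 < 2 ^ (L + d + 2) := by
    have h : d * L ≤ 2 ^ (L + d) := by
      rw [pow_add, mul_comm]
      exact Nat.mul_le_mul Nat.lt_two_pow_self.le Nat.lt_two_pow_self.le
    have := Nat.one_le_two_pow (n := L + d)
    rw [pow_add _ _ 2]
    omega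
  calc (2 * n ^ d + 1) ^ n ≤ (2 ^ (d * L + 2)) ^ n := Nat.pow_le_pow_left h1 n
    _ = 2 ^ ((d * L + 2) * n) := (pow_mul _ _ _).symm
    _ < 2 ^ 2 ^ (2 * L + d + 2) := by
        refine Nat.pow_lt_pow_right one_lt_two ?_
        calc (d * L + 2) * n ≤ (d * L + 2) * 2 ^ L := Nat.mul_le_mul_left _ hL
          _ < 2 ^ (L + d + 2) * 2 ^ L := Nat.mul_lt_mul_of_pos_right h2 (by positivity)
          _ = _ := by rw [← pow_add]; congr 1; omega

lemma pow_lt_two_pow_clog (n d : ℕ) : n ^ d < 2 ^ (d * Nat.clog 2 n + 1) := by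
  calc n ^ d ≤ (2 ^ Nat.clog 2 n) ^ d :=
        Nat.pow_le_pow_left (Nat.le_pow_clog one_lt_two n) d
    _ = 2 ^ (d * Nat.clog 2 n) := by rw [← pow_mul, mul_comm]
    _ < _ := Nat.pow_lt_pow_right one_lt_two (Nat.lt_succ_self _)

lemma clog_mul_half_pow_le {n r : ℕ} {f : ℝ} (hr : (1 / 2 : ℝ) ^ r ≤ f) :
    n * (2 * (1 / 2 : ℝ) ^ (Nat.clog 2 n + r)) ≤ 2 * f := by
  have h1 : (n : ℝ) * (1 / 2) ^ Nat.clog 2 n ≤ 1 := by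
    rw [one_div, inv_pow, ← div_eq_mul_inv, div_le_one (by positivity)]
    exact_mod_cast Nat.le_pow_clog one_lt_two n
  have h2 : (0 : ℝ) ≤ (1 / 2) ^ r := by positivity
  calc n * (2 * (1 / 2 : ℝ) ^ (Nat.clog 2 n + r)) =
        2 * ((n * (1 / 2) ^ Nat.clog 2 n) * (1 / 2) ^ r) := by rw [pow_add]; ring
    _ ≤ 2 * (1 * f) := by gcongr
    _ = _ := by ring

/-- The total number of bits is polynomial in `l = log n / ε`. -/
lemma space_bound {l ε f a : ℝ} {d r L B : ℕ} (hε : 0 < ε) (hl : 1 ≤ l)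
    (hlε : 1 / ε ≤ l) (hf : 0 < f) (hf1 : f ≤ 1) (hL : (L : ℝ) ≤ 2 * l) (ha : 0 ≤ a)
    (hr : 1 ≤ r) (hε1 : ε ≤ 1)
    (hB : B = ⌈393216 * ((L + r : ℕ) : ℝ) * (1 + l ^ a) *
      (576 * ((((2 * d + 1) * L : ℕ) : ℝ) + 1) / (ε ^ 2 * f)) ^ 2 / (ε ^ 2 * f)⌉₊) :
    ((2 * L + d + 2 + (L + 1) * ((L + r) * B) * ((d + 1) * L + 1 + 1) : ℕ) : ℝ) ≤
      ((d + 6) + 3 * (r + 2) * (2 * (393216 * (r + 2) * 2 *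
        (576 * (4 * d + 3) / f) ^ 2 / f)) * (2 * d + 4)) * l ^ (a + 12) := by
  have hl0 : 0 < l := by linarith
  have hla : 1 ≤ l ^ a := Real.one_le_rpow hl ha
  have hd : (0 : ℝ) ≤ d := Nat.cast_nonneg d
  have hr1 : (1 : ℝ) ≤ r := by exact_mod_cast hr
  have hL0 : (0 : ℝ) ≤ L := Nat.cast_nonneg L
  have hε2 : 1 / ε ^ 2 ≤ l ^ 2 := by
    rw [← one_div_pow]
    gcongr
  -- Powers of `l`: the levels, the repetitions and the word length cost one each, `A` is of order
  -- `l ^ 3`, and `B` is of order `l * l ^ a * (l ^ 3) ^ 2 * l ^ 2 = l ^ (a + 9)`. The total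
  -- exponent is `a + 12`.
  have hR : ((L : ℝ) + r) ≤ (r + 2) * l := by nlinarith
  have hG : (2 * (d : ℝ) + 1) * L + 1 ≤ (4 * d + 3) * l := by nlinarith
  set A := 576 * ((((2 * d + 1) * L : ℕ) : ℝ) + 1) / (ε ^ 2 * f) with hA
  have hA1 : 1 ≤ A := by
    rw [hA, one_le_div (by positivity)]
    have h1 : ε ^ 2 * f ≤ 1 := mul_le_one₀ (pow_le_one₀ hε.le hε1) hf.le hf1
    have h2 : (0 : ℝ) ≤ (((2 * d + 1) * L : ℕ) : ℝ) := Nat.cast_nonneg _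
    linarith
  have hAle : A ≤ 576 * (4 * d + 3) / f * l ^ 3 := by
    have h0 : A = 576 * ((2 * (d : ℝ) + 1) * L + 1) / f * (1 / ε ^ 2) := by
      rw [hA]
      push_cast
      field_simp
    rw [h0]
    calc 576 * ((2 * (d : ℝ) + 1) * L + 1) / f * (1 / ε ^ 2)
        ≤ 576 * ((4 * d + 3) * l) / f * l ^ 2 := by gcongr
      _ = _ := by ring
  set X := 393216 * ((L + r : ℕ) : ℝ) * (1 + l ^ a) * A ^ 2 / (ε ^ 2 * f) with hX
  have hX1 : 1 ≤ X := by
    rw [hX, one_le_div (by positivity)]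
    have h1 : ε ^ 2 * f ≤ 1 := mul_le_one₀ (pow_le_one₀ hε.le hε1) hf.le hf1
    have h2 : (1 : ℝ) ≤ ((L + r : ℕ) : ℝ) := by push_cast; linarith
    calc ε ^ 2 * f ≤ 1 * 1 * 1 * 1 ^ 2 := by linarith
      _ ≤ 393216 * ((L + r : ℕ) : ℝ) * (1 + l ^ a) * A ^ 2 := by
          gcongr
          · linarith
          · linarith
  have hXle : X ≤ 393216 * (r + 2) * 2 * (576 * (4 * d + 3) / f) ^ 2 / f * (l ^ a * l ^ 9) := by
    have h0 : X = 393216 * ((L : ℝ) + r) * (1 + l ^ a) * A ^ 2 / f * (1 / ε ^ 2) := by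
      rw [hX]
      push_cast
      field_simp
    rw [h0]
    calc 393216 * ((L : ℝ) + r) * (1 + l ^ a) * A ^ 2 / f * (1 / ε ^ 2)
        ≤ 393216 * ((r + 2) * l) * (l ^ a + l ^ a) *
          (576 * (4 * d + 3) / f * l ^ 3) ^ 2 / f * l ^ 2 := by gcongr
      _ = _ := by ring
  set b := 393216 * ((r : ℝ) + 2) * 2 * (576 * (4 * d + 3) / f) ^ 2 / f with hb
  have hb0 : 0 ≤ b := by positivity
  have hBle : (B : ℝ) ≤ 2 * b * (l ^ a * l ^ 9) := by
    rw [hB]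
    have := Nat.ceil_lt_add_one (show 0 ≤ X by linarith)
    linarith
  have hq : 2 * (L : ℝ) + d + 2 ≤ (d + 6) * l := by nlinarith
  have hw : ((d : ℝ) + 1) * L + 1 + 1 ≤ (2 * d + 4) * l := by nlinarith
  have hLl : (L : ℝ) + 1 ≤ 3 * l := by linarith
  have hl12 : l ≤ l ^ a * l ^ 12 := by
    calc l = 1 * l ^ 1 := by ring
      _ ≤ l ^ a * l ^ 12 := by
        gcongr
        norm_num
  have hpow : l ^ (a + 12) = l ^ a * l ^ 12 := by
    rw [Real.rpow_add hl0]
    norm_cast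
  push_cast
  rw [hpow]
  calc 2 * (L : ℝ) + d + 2 + (L + 1) * ((L + r) * B) * ((d + 1) * L + 1 + 1)
      ≤ (d + 6) * l + 3 * l * ((r + 2) * l * (2 * b * (l ^ a * l ^ 9))) *
          ((2 * d + 4) * l) := by gcongr
    _ = (d + 6) * l + 3 * (r + 2) * (2 * b) * (2 * d + 4) * (l ^ a * l ^ 12) := by ring
    _ ≤ (d + 6) * (l ^ a * l ^ 12) +
          3 * (r + 2) * (2 * b) * (2 * d + 4) * (l ^ a * l ^ 12) := by gcongr
    _ = _ := by ring

end Space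

/-! ### Choice of parameters and conclusion -/

theorem corollary7 (c : ℝ) :
    ∃ C : ℝ, ∀ (d : ℕ) (δ : ℝ), 0 < δ → ∃ K : ℝ,
      ∀ (n : ℕ), 2 ≤ n → ∀ (ε p T : ℝ), ε ∈ Set.Ioo (0 : ℝ) 1 → p ∈ Set.Icc (0 : ℝ) 2 → 0 ≤ T →
        ∃ S : LinearSketch n,
          S.UsesBits (n ^ d) (K * (Real.logb 2 n / ε) ^ C) ∧
          ∀ x : Fin n → ℤ, (∀ i, |x i| ≤ (n : ℤ) ^ d) →
            ∀ k : ℕ,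
              IsGreatest {j : ℕ | 1 ≤ j ∧ j ≤ n ∧ T ≤ |(sortedEntry x j : ℝ)|} k →
              (sortedEntry x k : ℝ) ^ 2 ≥ (ε / Real.logb 2 n) ^ c * (tailSq x k / k) →
              1 - δ ≤ S.prob x (fun Z =>
                |Z - largeMoment p T x| ≤
                  ε * largeMoment p T x + (1 + ε) * T ^ p * (nearCount ε T x : ℝ)) := by
  -- As `ε / log n ≤ 1`, the promise with exponent `c` implies the one with any larger exponent, so
  -- a nonnegative exponent may be used.
  set a := max c 0 with ha_def
  have ha : 0 ≤ a := le_max_right _ _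
  refine ⟨a + 12, fun d δ hδ => ?_⟩
  -- This is the failure probability demanded by Newman's theorem. It is split evenly among the
  -- three failure events: `r` gives `2 * (f / 6)`, and `576 = 3 * 192` in `A` and `393216 = 3 *
  -- 131072` in `B` give `f / 3` each.
  set f := (1 / 4 : ℝ) ^ (1 / δ) with hf_def
  have hf : 0 < f := by positivity
  have hf1 : f ≤ 1 := Real.rpow_le_one (by norm_num) (by norm_num) (by positivity)
  obtain ⟨r, hr⟩ : ∃ r : ℕ, (1 / 2 : ℝ) ^ r < f / 6 :=
    exists_pow_lt_of_lt_one (by positivity) (by norm_num)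
  have hr1 : 1 ≤ r := by
    rcases Nat.eq_zero_or_pos r with rfl | h
    · rw [pow_zero] at hr
      linarith
    · exact h
  refine ⟨((d + 6) + 3 * (r + 2) * (2 * (393216 * (r + 2) * 2 *
    (576 * (4 * d + 3) / f) ^ 2 / f)) * (2 * d + 4)), fun n hn ε p T hε hp hT => ?_⟩
  have hε0 := hε.1
  have hlog : (1 : ℝ) ≤ Real.logb 2 n := by
    rw [Real.le_logb_iff_rpow_le one_lt_two (by positivity), Real.rpow_one]
    exact_mod_cast hn
  set l := Real.logb 2 n / ε with hl_def
  have hlε : 1 / ε ≤ l := by rw [hl_def]; gcongr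
  have hl : 1 ≤ l := le_trans (by rw [le_div_iff₀ hε0]; linarith [hε.2]) hlε
  have hl0 : 0 < l := by linarith
  set L := Nat.clog 2 n with hL_def
  have hL : (L : ℝ) ≤ 2 * l := by
    refine (clog_le_two_mul_logb hn).trans ?_
    gcongr
    rw [hl_def, le_div_iff₀ hε0]
    nlinarith [hε.2]
  set A := 576 * ((((2 * d + 1) * L : ℕ) : ℝ) + 1) / (ε ^ 2 * f) with hA_def
  have hA0 : 0 < A := by positivity
  obtain ⟨B, hB⟩ : ∃ B : ℕ, B = ⌈393216 * ((L + r : ℕ) : ℝ) * (1 + l ^ a) * A ^ 2 /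
    (ε ^ 2 * f)⌉₊ := ⟨_, rfl⟩
  have hR : 0 < L + r := by omega
  have hB0 : 0 < B := by
    rw [hB, Nat.ceil_pos]
    have : (0 : ℝ) < ((L + r : ℕ) : ℝ) := by exact_mod_cast hR
    positivity
  have : NeZero n := ⟨by omega⟩
  have : NeZero (L + r) := ⟨by omega⟩
  have : NeZero B := ⟨by omega⟩
  have hT' : 1 ≤ max T 1 := le_max_right _ _
  have hA8 : 8 / ε ≤ A := by
    rw [hA_def, div_le_div_iff₀ hε0 (by positivity)]
    have h1 : ε ^ 2 * f ≤ ε := by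
      calc ε ^ 2 * f ≤ ε ^ 2 * 1 := by gcongr
        _ ≤ ε := by nlinarith [hε.2]
    have h2 : (0 : ℝ) ≤ (((2 * d + 1) * L : ℕ) : ℝ) := Nat.cast_nonneg _
    nlinarith
  have hfail : n * (2 * (1 / 2 : ℝ) ^ (L + r)) +
      131072 * ((L + r : ℕ) : ℝ) * (1 + l ^ a) * A ^ 2 / (ε ^ 2 * B) +
      ((((2 * d + 1) * L : ℕ) : ℝ) + 1) * (192 / (ε ^ 2 * A)) ≤ f := by
    have h1 := clog_mul_half_pow_le (n := n) hr.le
    have h2 : 131072 * ((L + r : ℕ) : ℝ) * (1 + l ^ a) * A ^ 2 / (ε ^ 2 * B) ≤ f / 3 := by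
      have hBr : (0 : ℝ) < B := by exact_mod_cast hB0
      have h := Nat.le_ceil (393216 * ((L + r : ℕ) : ℝ) * (1 + l ^ a) * A ^ 2 / (ε ^ 2 * f))
      rw [← hB, div_le_iff₀ (by positivity)] at h
      rw [div_le_iff₀ (by positivity)]
      linarith
    have h3 : ((((2 * d + 1) * L : ℕ) : ℝ) + 1) * (192 / (ε ^ 2 * A)) = f / 3 := by
      rw [hA_def]
      field_simp
      norm_num
    rw [← hL_def] at h1
    linarith
  have hcore : ∀ x : Fin n → ℤ, (∀ i, |x i| ≤ ((n ^ d : ℕ) : ℤ)) → ∀ T' : ℝ, 1 ≤ T' →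
      (∃ i, T' ≤ |(x i : ℝ)|) → ∀ m : ℝ, 0 ≤ m → (∀ i, T' ≤ |(x i : ℝ)| → m ≤ |(x i : ℝ)|) →
      (∑ i ∈ univ.filter (fun i => ¬ T' ≤ |(x i : ℝ)|), (x i : ℝ) ^ 2 ≤
        l ^ a * ((univ.filter fun i => T' ≤ |(x i : ℝ)|).card * m ^ 2)) →
      unifProb (fun ω : SketchSeed n (L + r) B =>
        ¬ |momentDecode ε p T' A ((2 * d + 1) * L) ω ((sketchMatrix ω).mulVec x) -
          largeMoment p T' x| ≤
          ε * largeMoment p T' x + (1 + ε) * T' ^ p * (nearCount ε T' x : ℝ)) ≤ f := by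
    intro x hx T' hT1 hne m hm hmin htail
    refine (unifProb_momentDecode_fail_le hε hp hT1 hA8 (by positivity) hm hne hmin htail
      ?_).trans hfail
    -- The range of scales suffices because the moment is at most `n * (n ^ d) ^ 2 = n ^ (2 * d +
    -- 1)`.
    refine (largeMoment_le hp hT1 hx).trans_lt ?_
    have h := pow_lt_two_pow_clog n (2 * d + 1)
    rw [← hL_def] at h
    have h' : (n : ℝ) ^ (2 * d + 1) < 2 ^ ((2 * d + 1) * L + 1) := by exact_mod_cast h
    refine lt_of_eq_of_lt ?_ h'
    push_cast
    ring
  obtain ⟨S, hS, hgood⟩ := exists_linearSketch (Ω := SketchSeed n (L + r) B)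
    (m := n ^ d) (q := 2 * L + d + 2) (w := (d + 1) * L + 1) sketchMatrix
    (momentDecode ε p (max T 1) A ((2 * d + 1) * L)) hδ (card_inputs_lt d)
    (by
      intro ω x hx j
      refine (abs_sketch_le ω x hx j).trans_lt ?_
      have h := pow_lt_two_pow_clog n (d + 1)
      rw [pow_succ, mul_comm] at h
      exact_mod_cast h)
    (fun x Z => |Z - largeMoment p T x| ≤
      ε * largeMoment p T x + (1 + ε) * T ^ p * (nearCount ε T x : ℝ))
    (fun x => ∃ k : ℕ, IsGreatest {j : ℕ | 1 ≤ j ∧ j ≤ n ∧ T ≤ |(sortedEntry x j : ℝ)|} k ∧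
      (sortedEntry x k : ℝ) ^ 2 ≥ (ε / Real.logb 2 n) ^ c * (tailSq x k / k))
    (by
      rintro x hx ⟨k, hk, hcond⟩
      rcases le_or_gt 1 T with h1 | h1
      · rw [max_eq_left h1]
        refine hcore x hx T h1 (exists_large hk) |(sortedEntry x k : ℝ)| (abs_nonneg _)
          (fun i hi => abs_sortedEntry_le hk hi) ?_
        rw [sum_small_eq_tailSq hk, card_large hk, sq_abs]
        have hk0 : (0 : ℝ) < k := by exact_mod_cast hk.1.1
        have htail0 : 0 ≤ tailSq x k / k :=
          div_nonneg (Finset.sum_nonneg fun _ _ => sq_nonneg _) hk0.le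
        have hbase : ε / Real.logb 2 n = l⁻¹ := by rw [hl_def, inv_div]
        have hpow : l⁻¹ ^ a ≤ (ε / Real.logb 2 n) ^ c := by
          rw [hbase]
          exact Real.rpow_le_rpow_of_exponent_ge (by positivity) (inv_le_one_of_one_le₀ hl)
            (le_max_left _ _)
        have h2 : (l ^ a)⁻¹ * (tailSq x k / k) ≤ (sortedEntry x k : ℝ) ^ 2 := by
          rw [← Real.inv_rpow hl0.le]
          exact (mul_le_mul_of_nonneg_right hpow htail0).trans hcond
        rw [inv_mul_le_iff₀ (by positivity), div_le_iff₀ hk0] at h2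
        linarith
      -- Threshold `1` gives the same moment, with zero tail and no coordinates just below it. The
      -- bound obtained there is at least as strong as the required one, and the promise plays no
      -- role.
      · rw [max_eq_right h1.le]
        have hT0 : 0 ≤ (1 + ε) * T ^ p * (nearCount ε T x : ℝ) := by positivity
        rw [largeMoment_of_le_one p h1.le]
        by_cases hne : ∃ i, (1 : ℝ) ≤ |(x i : ℝ)|
        · have h := hcore x hx 1 le_rfl hne 0 le_rfl (fun i _ => abs_nonneg _)
            (by rw [sum_small_one]; simp)
          rw [nearCount_one hε.2] at h
          refine (unifProb_mono fun ω hω hle => hω ?_).trans h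
          simp only [Nat.cast_zero, mul_zero, add_zero] at hle
          linarith
        · have hx0 : x = 0 := by
            funext i
            by_contra hi
            exact hne ⟨i, one_le_abs_intCast hi⟩
          have hF : largeMoment p 1 x = 0 := by
            rw [hx0, largeMoment]
            exact Finset.sum_eq_zero fun i _ => by simp [absPow]
          refine (unifProb_mono (Q := fun _ => False) fun ω hω => ?_).trans ?_
          · refine hω ?_
            have hZ : momentDecode ε p 1 A ((2 * d + 1) * L) ω ((sketchMatrix ω).mulVec x) = 0 := by
              rw [hx0, Matrix.mulVec_zero]
              exact momentEstimate_zero hε le_rfl (by positivity) ω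
            rw [hZ, hF]
            simpa using hT0
          · simp only [unifProb, if_false, Finset.expect_const_zero]
            exact hf.le)
  refine ⟨S, ?_, fun x hx k hk hcond => hgood x (by exact_mod_cast hx) ⟨k, hk, hcond⟩⟩
  obtain ⟨w, hw, hbits⟩ := hS
  refine ⟨w, hw, hbits.trans ?_⟩
  have hrow : Fintype.card (SketchRow n (L + r) B) = (L + 1) * ((L + r) * B) := by
    simp [SketchRow, hL_def]
  rw [hrow]
  exact space_bound hε0 hl hlε hf hf1 hL ha hr1 hε.2.le hB
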